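/- **Setting.** Let $Q$ be a finite-dimensional (Hausdorff) smooth manifold, $L:TQ\to\mathbb R$ a smooth regular Lagrangian (its Hessian in the velocities is nondegenerate), and $\mathcal D\subseteq TQ$ a regular distribution, i.e. a smooth vector subbundle $\tau:\mathcal D\to Q$ with inclusion $i_{\mathcal D}$. Let $S$ be the vertical endomorphism of $T(TQ)$, $\Delta$ the Liouville vector field, $\omega_L=-d(S^*dL)$, $E_L=\Delta L-L$, $F^o=S^*((T\mathcal D)^o)$ along $\mathcal D$, and $\sharp$ the inverse of $X\mapsto i_X\omega_L$. Assume that the nonholonomic system $(Q,L,\mathcal D)$ is regular: $\dim (T_v\mathcal D)^o=\dim F^o_v$ and $T_v\mathcal D\cap\sharp(F^o_v)=\{0\}$ for all $v\in\mathcal D$. Let $\Gamma_{nh}\in\mathfrak X(\mathcal D)$ be the nonholonomic vector field, the unique solution of $i_{\Gamma_{nh}}\omega_L-dE_L\in F^o$ tangent to $\mathcal D$, and let $\phi_t$ be its flow. Let $h>0$, let $\mathcal U_h\subseteq\mathcal D$ be an open set of vectors whose trajectories are defined on $[0,h]$ on which the nonholonomic exponential map $\exp_h(v)=(\tau(v),\tau(\phi_h(v)))$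 is a smooth embedding into $Q\times Q$, and put $$\mathcal M_h=\exp_h(\mathcal U_h),\qquad R^-=(\exp_h|_{\mathcal U_h})^{-1}:\mathcal M_h\to\mathcal U_h,\qquad R^+=\phi_h\circ R^-:\mathcal M_h\to\phi_h(\mathcal U_h).$$ The exact discrete flow is $\Phi=\exp_h\circ R^+$; as a map into $\mathcal M_h$ it is defined at those $x\in\mathcal M_h$ with $R^+(x)\in\mathcal U_h$. Let $l=L|_{\mathcal D}$, let $\mathbb Fl:\mathcal D\to\mathcal D^*$, $\langle\mathbb Fl(u),v\rangle=\frac{d}{dt}\big|_{t=0}l(u+tv)$, be the nonholonomic Legendre map, and let $\mathbb F^{\pm}l=\mathbb Fl\circ R^{\pm}:\mathcal M_h\to\mathcal D^*$ be the exact discrete nonholonomic Legendre transformations. **Theorem.** 1. Let $N\ge 1$, let $(q_0,q_1)\in\mathcal M_h$, and let $(q_0,q_1,\dots,q_N)$ be obtained by iterating $\Phi$: for $1\le k\le N-1$, $\Phi$ is defined at $(q_{k-1},q_k)$ and $(q_k,q_{k+1})=\Phi(q_{k-1},q_k)$. Then the exact discrete nonholonomic equations hold: $(q_k,q_{k+1})\in\mathcal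 M_h$ for $0\le k\le N-1$, and $\mathbb F^+l(q_{k-1},q_k)=\mathbb F^-l(q_k,q_{k+1})$ for $1\le k\le N-1$. Moreover there is a trajectory $\gamma$ of $\Gamma_{nh}$ on $[0,Nh]$, with base curve $q_{0,1}=\tau\circ\gamma$, such that $\gamma(0)\in\mathcal U_h$, $q_{0,1}(0)=q_0$, $q_{0,1}(h)=q_1$ and $$q_k=q_{0,1}(kh),\qquad 0\le k\le N,$$ and it is unique: any trajectory $\gamma'$ of $\Gamma_{nh}$ on an interval $[0,T]$, $T\ge h$, with $\gamma'(0)\in\mathcal U_h$, $\tau(\gamma'(0))=q_0$ and $\tau(\gamma'(h))=q_1$ agrees with $\gamma$ on $[0,\min(T,Nh)]$. 2. Let $\mathcal V\subseteq\mathcal D$ be an open set on which $\Gamma_{nh}$ can be pushed forward by $\mathbb Fl$, that is, for $v\in\mathcal V$ the vector $T\mathbb Fl(\Gamma_{nh}(v))$ depends only on $\mathbb Fl(v)$ (this holds whenever $\mathbb Fl$ is injective on $\mathcal V$; one may take $\mathcal V=\mathcal D$ if $\mathbb Fl$ is injective). Let $\bar\Gamma_{nh}=(\mathbb Fl)_*(\Gamma_{nh}|_{\mathcal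 V})$ be the resulting vector field on $\mathbb Fl(\mathcal V)\subseteq\mathcal D^*$, with flow $\phi^{\bar\Gamma_{nh}}_t$, and let $\mathcal M_h^{\mathcal V}$ be the set of all $x\in\mathcal M_h$ with $\phi_t(R^-(x))\in\mathcal V$ for all $t\in[0,h]$ (so that $\mathcal M_h^{\mathcal D}=\mathcal M_h$). Then for every $x\in\mathcal M_h^{\mathcal V}$ the flow $\phi_h^{\bar\Gamma_{nh}}$ is defined at $\mathbb F^-l(x)$ and $$\mathbb F^+l(x)=\phi_h^{\bar\Gamma_{nh}}\bigl(\mathbb F^-l(x)\bigr).$$ That is, on $\mathbb F^-l(\mathcal M_h^{\mathcal V})$ the map $\phi_h^{\bar\Gamma_{nh}}$ coincides with the exact discrete flow $\varphi_h=\mathbb F^+l\circ(\mathbb F^-l|_{\mathcal M^{\mathcal V}_h})^{-1}$ on $\mathcal D^*$. -/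

import Mathlib

open Set Bundle
open scoped Manifold ContDiff Topology

noncomputable section

namespace Nonholonomic

/-! ### Vector fields, flows, push-forwards and one-forms on a manifold -/

section Manifolds

variable {V : Type*} [NormedAddCommGroup V] [NormedSpace ℝ V]
  {H : Type*} [TopologicalSpace H] {J : ModelWithCorners ℝ V H}
  {M : Type*} [TopologicalSpace M] [ChartedSpace H M]
  {V' : Type*} [NormedAddCommGroup V'] [NormedSpace ℝ V']
  {H' : Type*} [TopologicalSpace H'] {J' : ModelWithCorners ℝ V' H'}
  {M' : Type*} [TopologicalSpace M'] [ChartedSpace H' M']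

/-- `γ` is an integral curve of the vector field `X` defined on (a neighbourhood of) the time
interval `[0, T]`. -/
def IsTrajectory (X : ∀ x : M, TangentSpace J x) (γ : ℝ → M) (T : ℝ) : Prop :=
  ∃ ε > 0, IsMIntegralCurveOn γ X (Ioo (-ε) (T + ε))

/-- The set of points whose trajectory under `X` is defined for all times in `[0, T]`. -/
def flowDomain (X : ∀ x : M, TangentSpace J x) (T : ℝ) : Set M :=
  {x | ∃ γ : ℝ → M, γ 0 = x ∧ IsTrajectory X γ T}

open Classical in
/-- The flow `φ_t^X` of a vector field at a time `t ≥ 0`; it is meaningful on `flowDomain X t`. -/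
def flow (X : ∀ x : M, TangentSpace J x) (t : ℝ) (x : M) : M :=
  if h : x ∈ flowDomain X t then h.choose t else x

/-- On `S`, the vector `T f (X x)` depends on `x` only through `f x`, so that the push-forward of
`X|_S` by `f` is a well defined vector field on `f(S)`. This holds when `f` is injective on `S`. -/
def IsProjectableOn (f : M → M') (S : Set M) (X : ∀ x : M, TangentSpace J x) : Prop :=
  ∀ x ∈ S, ∀ y ∈ S, f x = f y →
    tangentMap J J' f (⟨x, X x⟩ : TangentBundle J M) =
      tangentMap J J' f (⟨y, X y⟩ : TangentBundle J M)

open Classical in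
/-- The push-forward `f_* X` of `X|_S`: its value at `f x`, with `x ∈ S`, is `T_x f (X x)`
(and it is `0` outside `f(S)`). -/
def pushforward (f : M → M') (S : Set M) (X : ∀ x : M, TangentSpace J x) (y : M') :
    TangentSpace J' y :=
  if h : ∃ x ∈ S, f x = y then h.choose_spec.2 ▸ mfderiv J J' f h.choose (X h.choose) else 0

/-- The exterior derivative `dθ(X, Y)` of a one-form at the point `x`, computed in the chart
at `x`, with the convention `dθ(X, Y) = X(θ(Y)) - Y(θ(X)) - θ([X, Y])`. -/
def extDerivOneForm (θ : ∀ x : M, TangentSpace J x →L[ℝ] ℝ) (x : M)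
    (X Y : TangentSpace J x) : ℝ :=
  let θc : V → V →L[ℝ] ℝ := fun y =>
    (θ ((extChartAt J x).symm y)).comp (mfderiv 𝓘(ℝ, V) J (extChartAt J x).symm y)
  let Xc : V := mfderiv J 𝓘(ℝ, V) (extChartAt J x) x X
  let Yc : V := mfderiv J 𝓘(ℝ, V) (extChartAt J x) x Y
  fderiv ℝ θc (extChartAt J x x) Xc Yc - fderiv ℝ θc (extChartAt J x x) Yc Xc

/-- The differential `d_x f` of a real-valued function, as a linear form on `T_x M`. -/
def differential (J : ModelWithCorners ℝ V H) (f : M → ℝ) (x : M) : TangentSpace J x →L[ℝ] ℝ :=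
  mfderiv J 𝓘(ℝ, ℝ) f x

end Manifolds

/-! ### Fibre derivatives -/

section FibreDerivative

variable {Q : Type*} [TopologicalSpace Q]
  {F : Type*} [NormedAddCommGroup F] [NormedSpace ℝ F]
  {W : Q → Type*} [TopologicalSpace (TotalSpace F W)] [∀ q, TopologicalSpace (W q)]
  [∀ q, AddCommGroup (W q)] [∀ q, Module ℝ (W q)] [FiberBundle F W] [VectorBundle ℝ F W]

/-- The fibre derivative of a function `f` on the total space of a vector bundle at `u`: the linear
form `w ↦ d/dt|_{t=0} f(u + t w)` on the fibre through `u` (see `fibreDerivative_apply`).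
The trivialization serves only to identify the fibre with a normed space. -/
def fibreDerivative (f : TotalSpace F W → ℝ) (u : TotalSpace F W) : W u.proj →L[ℝ] ℝ :=
  let e := trivializationAt F W u.proj
  (fderiv ℝ (fun w : F => f ⟨u.proj, e.symmL ℝ u.proj w⟩)
    (e.continuousLinearMapAt ℝ u.proj u.2)).comp (e.continuousLinearMapAt ℝ u.proj)

theorem fibreDerivative_apply (f : TotalSpace F W → ℝ) (u : TotalSpace F W)
    (hf : DifferentiableAt ℝ
      (fun w : F => f ⟨u.proj, (trivializationAt F W u.proj).symmL ℝ u.proj w⟩)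
      ((trivializationAt F W u.proj).continuousLinearMapAt ℝ u.proj u.2)) (w : W u.proj) :
    fibreDerivative f u w = deriv (fun t : ℝ => f ⟨u.proj, u.2 + t • w⟩) 0 := by
  set e := trivializationAt F W u.proj with he
  have hb : u.proj ∈ e.baseSet := mem_baseSet_trivializationAt F W u.proj
  have hline : HasDerivAt (fun t : ℝ => e.continuousLinearMapAt ℝ u.proj u.2
      + t • e.continuousLinearMapAt ℝ u.proj w) (e.continuousLinearMapAt ℝ u.proj w) 0 := by
    simpa using ((hasDerivAt_id (0 : ℝ)).smul_const
      (e.continuousLinearMapAt ℝ u.proj w)).const_add (e.continuousLinearMapAt ℝ u.proj u.2)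
  have h0 : HasFDerivAt (fun w : F => f ⟨u.proj, e.symmL ℝ u.proj w⟩)
      (fderiv ℝ (fun w : F => f ⟨u.proj, e.symmL ℝ u.proj w⟩)
        (e.continuousLinearMapAt ℝ u.proj u.2))
      (e.continuousLinearMapAt ℝ u.proj u.2 + (0 : ℝ) • e.continuousLinearMapAt ℝ u.proj w) := by
    simpa using hf.hasFDerivAt
  have hc := h0.comp_hasDerivAt (0 : ℝ) hline
  have hfun : ((fun w : F => f ⟨u.proj, e.symmL ℝ u.proj w⟩) ∘ fun t : ℝ =>
      e.continuousLinearMapAt ℝ u.proj u.2 + t • e.continuousLinearMapAt ℝ u.proj w)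
      = fun t : ℝ => f ⟨u.proj, u.2 + t • w⟩ := by
    funext t
    have : e.symmL ℝ u.proj (e.continuousLinearMapAt ℝ u.proj u.2
        + t • e.continuousLinearMapAt ℝ u.proj w) = u.2 + t • w := by
      rw [← map_smul, ← map_add]
      exact e.symmL_continuousLinearMapAt (R := ℝ) hb _
    simp only [Function.comp_apply, this]
  rw [hfun] at hc
  exact hc.deriv.symm

end FibreDerivative

/-! ### Lagrangian mechanics on `TQ` -/

section Lagrangian

variable {E : Type*} [NormedAddCommGroup E] [NormedSpace ℝ E]
  {Q : Type*} [TopologicalSpace Q] [ChartedSpace E Q] [IsManifold 𝓘(ℝ, E) ∞ Q]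

/-- The vertical lift `w ↦ w^V_u = d/dt|_{t=0} (u + t w)` from `T_q Q` to `T_u (TQ)`, as the
derivative of the inclusion of the fibre `T_q Q` into `TQ`. -/
def verticalLift (u : TangentBundle 𝓘(ℝ, E) Q) :
    TangentSpace 𝓘(ℝ, E) u.proj →L[ℝ] TangentSpace (𝓘(ℝ, E).tangent) u :=
  mfderiv 𝓘(ℝ, E) (𝓘(ℝ, E).tangent)
    (fun w : E => (⟨u.proj, w⟩ : TangentBundle 𝓘(ℝ, E) Q)) u.2

/-- The vertical endomorphism `S(X) = (T τ_Q (X))^V` of `T(TQ)`. -/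
def verticalEndomorphism (u : TangentBundle 𝓘(ℝ, E) Q) :
    TangentSpace (𝓘(ℝ, E).tangent) u →L[ℝ] TangentSpace (𝓘(ℝ, E).tangent) u :=
  (verticalLift u).comp (mfderiv (𝓘(ℝ, E).tangent) 𝓘(ℝ, E)
    (fun v : TangentBundle 𝓘(ℝ, E) Q => v.proj) u)

variable (L : TangentBundle 𝓘(ℝ, E) Q → ℝ)

/-- The Poincaré–Cartan one-form `S^* dL`. -/
def cartanOneForm (u : TangentBundle 𝓘(ℝ, E) Q) :
    TangentSpace (𝓘(ℝ, E).tangent) u →L[ℝ] ℝ :=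
  (differential (𝓘(ℝ, E).tangent) L u).comp (verticalEndomorphism u)

/-- The Poincaré–Cartan two-form `ω_L = -d(S^* dL)`. -/
def cartanTwoForm (u : TangentBundle 𝓘(ℝ, E) Q)
    (X Y : TangentSpace (𝓘(ℝ, E).tangent) u) : ℝ :=
  -extDerivOneForm (cartanOneForm L) u X Y

/-- The energy `E_L = Δ L - L`, with `Δ(u) = u^V_u` the Liouville vector field. -/
def energy (u : TangentBundle 𝓘(ℝ, E) Q) : ℝ :=
  differential (𝓘(ℝ, E).tangent) L u (verticalLift u u.2) - L u

/-- `L` is regular: its Hessian in the velocities is nondegenerate at every point of `TQ`. -/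
def IsRegularLagrangian : Prop :=
  ∀ (q : Q) (v a : E),
    (∀ b : E, fderiv ℝ (fun w : E => fderiv ℝ
      (fun w' : E => L (⟨q, w'⟩ : TangentBundle 𝓘(ℝ, E) Q)) w) v a b = 0) → a = 0

end Lagrangian

/-! ### Nonholonomic systems -/

section NonholonomicSystem

variable {E : Type*} [NormedAddCommGroup E] [NormedSpace ℝ E]
  {Q : Type*} [TopologicalSpace Q] [ChartedSpace E Q] [IsManifold 𝓘(ℝ, E) ∞ Q]
  {F : Type*} [NormedAddCommGroup F] [NormedSpace ℝ F]
  {D : Q → Type*} [TopologicalSpace (TotalSpace F D)] [∀ q, TopologicalSpace (D q)]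
  [∀ q, AddCommGroup (D q)] [∀ q, Module ℝ (D q)] [FiberBundle F D] [VectorBundle ℝ F D]

variable (E F D) in
/-- A (regular) distribution on `Q`, i.e. a smooth vector subbundle of `TQ`: a smooth vector
bundle `D → Q` with a smooth, fibrewise linear and injective map `i_D : D → TQ` over `Q`. -/
structure Distribution where
  /-- the inclusion of the fibres -/
  incl : ∀ q : Q, D q →L[ℝ] TangentSpace 𝓘(ℝ, E) q
  incl_injective : ∀ q, Function.Injective (incl q)
  contMDiff_incl : ContMDiff (𝓘(ℝ, E).prod 𝓘(ℝ, F)) (𝓘(ℝ, E).tangent) ∞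
    (fun v : TotalSpace F D => (⟨v.proj, incl v.proj v.2⟩ : TangentBundle 𝓘(ℝ, E) Q))

variable (L : TangentBundle 𝓘(ℝ, E) Q → ℝ) (𝒟 : Distribution E F D)

/-- The inclusion `i_D : D → TQ`. -/
def Distribution.toTangent (v : TotalSpace F D) : TangentBundle 𝓘(ℝ, E) Q :=
  ⟨v.proj, 𝒟.incl v.proj v.2⟩

/-- The tangent map `T_v i_D : T_v D → T_v (TQ)`; its range is the tangent space of the
submanifold `D` of `TQ`. -/
def Distribution.tangentIncl (v : TotalSpace F D) :
    TangentSpace (𝓘(ℝ, E).prod 𝓘(ℝ, F)) v →L[ℝ]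
      TangentSpace (𝓘(ℝ, E).tangent) (𝒟.toTangent v) :=
  mfderiv (𝓘(ℝ, E).prod 𝓘(ℝ, F)) (𝓘(ℝ, E).tangent) 𝒟.toTangent v

/-- The annihilator `(T_v D)^o` of the tangent space of `D`, in the dual of `T_v (TQ)`. -/
def Distribution.tangentAnnihilator (v : TotalSpace F D) :
    Submodule ℝ (Module.Dual ℝ (TangentSpace (𝓘(ℝ, E).tangent) (𝒟.toTangent v))) :=
  (LinearMap.range (𝒟.tangentIncl v).toLinearMap).dualAnnihilator

/-- The space of constraint forces `F^o_v = S^*((T_v D)^o)`. -/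
def Distribution.forceAnnihilator (v : TotalSpace F D) :
    Submodule ℝ (Module.Dual ℝ (TangentSpace (𝓘(ℝ, E).tangent) (𝒟.toTangent v))) :=
  (𝒟.tangentAnnihilator v).map (verticalEndomorphism (𝒟.toTangent v)).toLinearMap.dualMap

/-- The nonholonomic system `(Q, L, D)` is regular: `L` is regular, and the admissibility and
compatibility conditions hold. In the latter, `♯` is the inverse of `X ↦ i_X ω_L`, so that
`X ∈ ♯(F^o)` says that `i_X ω_L ∈ F^o`. -/
structure IsRegularSystem : Prop where
  regular : IsRegularLagrangian L
  admissible : ∀ v : TotalSpace F D,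
    Module.finrank ℝ (𝒟.tangentAnnihilator v) = Module.finrank ℝ (𝒟.forceAnnihilator v)
  compatible : ∀ (v : TotalSpace F D)
    (X : TangentSpace (𝓘(ℝ, E).tangent) (𝒟.toTangent v)),
    X ∈ LinearMap.range (𝒟.tangentIncl v).toLinearMap →
    (∃ α ∈ 𝒟.forceAnnihilator v, ∀ Y, cartanTwoForm L (𝒟.toTangent v) X Y = α Y) → X = 0

/-- The vector `X ∈ T_v D` satisfies the nonholonomic equation `i_X ω_L - dE_L ∈ F^o_v`. -/
def IsNonholonomicVector (v : TotalSpace F D)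
    (X : TangentSpace (𝓘(ℝ, E).prod 𝓘(ℝ, F)) v) : Prop :=
  ∃ α ∈ 𝒟.forceAnnihilator v, ∀ Y : TangentSpace (𝓘(ℝ, E).tangent) (𝒟.toTangent v),
    cartanTwoForm L (𝒟.toTangent v) (𝒟.tangentIncl v X) Y
      - differential (𝓘(ℝ, E).tangent) (energy L) (𝒟.toTangent v) Y = α Y

open Classical in
/-- The nonholonomic vector field `Γ_nh` on `D`: its value at `v` is the solution `X ∈ T_v D` of
`i_X ω_L - dE_L ∈ F^o_v`, which exists and is unique when the system is regular. -/
def nhField (v : TotalSpace F D) : TangentSpace (𝓘(ℝ, E).prod 𝓘(ℝ, F)) v :=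
  if h : ∃ X, IsNonholonomicVector L 𝒟 v X then h.choose else 0

/-- The nonholonomic exponential map `exp_h(v) = (τ(v), τ(φ_h(v)))`, where `φ` is the flow of
`Γ_nh`. -/
def nhExp (h : ℝ) (v : TotalSpace F D) : Q × Q :=
  (v.proj, (flow (nhField L 𝒟) h v).proj)

/-- `U` is an admissible domain `U_h` for the nonholonomic exponential map: an open set of
initial velocities whose trajectories are defined on `[0, h]`, on which `exp_h` is a smooth
embedding into `Q × Q`. -/
structure IsExpDomain (h : ℝ) (U : TopologicalSpace.Opens (TotalSpace F D)) : Prop where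
  subset_flowDomain : (U : Set (TotalSpace F D)) ⊆ flowDomain (nhField L 𝒟) h
  isSmoothEmbedding : Manifold.IsSmoothEmbedding (𝓘(ℝ, E).prod 𝓘(ℝ, F))
    (𝓘(ℝ, E).prod 𝓘(ℝ, E)) ∞ (fun v : U => nhExp L 𝒟 h v)

variable (h : ℝ) (U : TopologicalSpace.Opens (TotalSpace F D))

/-- The exact discrete nonholonomic constraint submanifold `M_h = exp_h(U_h)` of `Q × Q`. -/
def exactConstraint : Set (Q × Q) := nhExp L 𝒟 h '' U

open Classical in
/-- The exact retraction `R⁻ = (exp_h|_{U_h})⁻¹ : M_h → U_h` (with the value `0` outside `M_h`). -/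
def retractionMinus (x : Q × Q) : TotalSpace F D :=
  if hx : ∃ v ∈ U, nhExp L 𝒟 h v = x then hx.choose else ⟨x.1, 0⟩

/-- `R⁺ = φ_h ∘ R⁻ : M_h → φ_h(U_h)`. -/
def retractionPlus (x : Q × Q) : TotalSpace F D :=
  flow (nhField L 𝒟) h (retractionMinus L 𝒟 h U x)

/-- The exact discrete flow `Φ = exp_h ∘ R⁺`. -/
def exactFlow (x : Q × Q) : Q × Q := nhExp L 𝒟 h (retractionPlus L 𝒟 h U x)

/-- The points of `M_h` at which the exact discrete flow is defined as a map into `M_h`, i.e. where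
`R⁺(x)` lies in the domain `U_h` of `exp_h`. -/
def exactFlowDomain : Set (Q × Q) :=
  {x | x ∈ exactConstraint L 𝒟 h U ∧ retractionPlus L 𝒟 h U x ∈ U}

variable (F D) in
/-- The total space of the dual bundle `D^* → Q`. -/
abbrev DualBundle := TotalSpace (F →L[ℝ] ℝ) (fun q => D q →L[ℝ] Bundle.Trivial Q ℝ q)

/-- The nonholonomic Legendre map `Fl : D → D^*` of the restriction `l = L ∘ i_D`. -/
def nhLegendre (v : TotalSpace F D) : DualBundle F D :=
  ⟨v.proj, fibreDerivative (fun u : TotalSpace F D => L (𝒟.toTangent u)) v⟩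

/-- The exact discrete nonholonomic Legendre transformation `F⁻l = Fl ∘ R⁻`. -/
def legendreMinus (x : Q × Q) : DualBundle F D :=
  nhLegendre L 𝒟 (retractionMinus L 𝒟 h U x)

/-- The exact discrete nonholonomic Legendre transformation `F⁺l = Fl ∘ R⁺`. -/
def legendrePlus (x : Q × Q) : DualBundle F D :=
  nhLegendre L 𝒟 (retractionPlus L 𝒟 h U x)

/-- The vector field `Γbar_nh = (Fl)_* Γ_nh` on `D^*`, where `Γ_nh` is restricted to `S ⊆ D`
(`S = D` gives the push-forward of the whole of `Γ_nh`). -/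
def nhDualField (S : Set (TotalSpace F D)) (μ : DualBundle F D) :
    TangentSpace (𝓘(ℝ, E).prod 𝓘(ℝ, F →L[ℝ] ℝ)) μ :=
  pushforward (nhLegendre L 𝒟) S (nhField L 𝒟) μ

/-- The pairs in `M_h` whose connecting trajectory `t ↦ φ_t(R⁻(x))`, `0 ≤ t ≤ h`, stays in `S`.
For `S = D` this is all of `M_h`. -/
def exactConstraintIn (S : Set (TotalSpace F D)) : Set (Q × Q) :=
  {x | x ∈ exactConstraint L 𝒟 h U ∧
    ∀ t ∈ Icc 0 h, flow (nhField L 𝒟) t (retractionMinus L 𝒟 h U x) ∈ S}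

open Classical in
/-- The exact discrete flow `F⁺l ∘ (F⁻l|_A)⁻¹` on `D^*`, for `A ⊆ M_h`; it is meaningful on
`F⁻l(A)`. -/
def exactDualFlow (A : Set (Q × Q)) (μ : DualBundle F D) : DualBundle F D :=
  if hμ : ∃ x ∈ A, legendreMinus L 𝒟 h U x = μ then legendrePlus L 𝒟 h U hμ.choose else μ

end NonholonomicSystem

end Nonholonomic

end

noncomputable section

namespace Nonholonomic

/-! ### Gluing and uniqueness of integral curves on a time interval. -/

section IntegralCurves

variable {V : Type*} [NormedAddCommGroup V] [NormedSpace ℝ V]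
  {H : Type*} [TopologicalSpace H] {J : ModelWithCorners ℝ V H}
  {M : Type*} [TopologicalSpace M] [ChartedSpace H M]
  {X : ∀ x : M, TangentSpace J x} {γ γ' : ℝ → M} {T T' : ℝ}

/-! Since `exp_h` is injective on `U`, a point `Φ(x) = exp_h(R⁺(x))` with `R⁺(x) ∈ U` satisfies
`R⁻(Φ(x)) = R⁺(x)`. Applying the Legendre map gives the discrete equations. The velocities `R⁻(q_k,
q_{k+1})` are thus successive time-`h` images under the flow, and the arcs of length `h` between
them glue to one trajectory. A competing trajectory starting in `U` with the same first two base
points has the same initial velocity, again by injectivity of `exp_h`, so it is the same curve. For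
part 2, the Legendre map carries a trajectory of `Γ_nh` inside `S` to a trajectory of the
push-forward, and the flow at its initial point must follow that curve.

All of this rests on uniqueness of integral curves, which also gives meaning to `flow`, defined by
choosing a trajectory. Hence both fields have to be shown `C¹`, although they are defined by
pointwise choice. This is the bulk of the proof and is done in bundle coordinates `(x, w)` on `D`,
where the inclusion is `j(x, w) = (x, A(x) w)` and `L` becomes a function `ℓ(x, y)`. The
nonholonomic equation splits into `ẋ = A w` and the Lagrange–d'Alembert equations, which are linear
in `ẇ` with coefficient the fibre Hessian `B(b, c) = D²ℓ((0, A b), (0, A c))`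
(`isNonholonomicVector_dParam_iff`). Compatibility makes `B` nondegenerate
(`fibreHessian_injective`), so `Γ_nh` has components `(A w, B⁻¹ r)` (`nhField_bundleParam`), which
are smooth.

The derivative of the Legendre map along the fibres is the same `B`, so this map is a local
diffeomorphism even where it is not injective. Composed with the coordinates of `D` it parametrizes
`D^*` locally, and there the push-forward has the components of `Γ_nh` (`contMDiffAt_nhDualField`).
-/

theorem IsTrajectory.isMIntegralCurveAt (hγ : IsTrajectory X γ T) {t : ℝ} (ht : t ∈ Icc 0 T) :
    IsMIntegralCurveAt γ X t := by
  obtain ⟨ε, hε, hγ⟩ := hγ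
  exact hγ.isMIntegralCurveAt (Ioo_mem_nhds (by linarith [ht.1]) (by linarith [ht.2]))

theorem IsTrajectory.mono (hγ : IsTrajectory X γ T) (h : T' ≤ T) : IsTrajectory X γ T' := by
  obtain ⟨ε, hε, hγ⟩ := hγ
  exact ⟨ε, hε, IsMIntegralCurveOn.mono hγ (Ioo_subset_Ioo_right (by linarith))⟩

variable [IsManifold J 1 M] [BoundarylessManifold J M]

/-- Both arcs run slightly past their endpoints, so local uniqueness makes them agree on a
neighbourhood of the junction. Near every time the glued curve then coincides with one of the two
arcs, and no one-sided derivatives have to be matched. -/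
theorem IsTrajectory.concat
    (hX : ContMDiffAt J J.tangent 1 (fun x => (⟨x, X x⟩ : TangentBundle J M)) (γ T))
    (hT : 0 ≤ T) (hT' : 0 ≤ T') (hγ : IsTrajectory X γ T) (hγ' : IsTrajectory X γ' T')
    (h : γ T = γ' 0) :
    IsTrajectory X (fun t => if t ≤ T then γ t else γ' (t - T)) (T + T') := by
  have hloc : γ =ᶠ[𝓝 T] fun t => γ' (t - T) := by
    refine isMIntegralCurveAt_eventuallyEq_of_contMDiffAt_boundaryless hX
      (hγ.isMIntegralCurveAt ⟨hT, le_rfl⟩) ?_ (by simpa using h)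
    have := (hγ'.isMIntegralCurveAt (t := 0) ⟨le_rfl, hT'⟩).comp_add (-T)
    simpa [Function.comp_def, sub_eq_add_neg] using this
  obtain ⟨ε, hε, hγ⟩ := hγ
  obtain ⟨ε', hε', hγ'⟩ := hγ'
  have congr_at : ∀ {c c' : ℝ → M} {t : ℝ}, c =ᶠ[𝓝 t] c' → IsMIntegralCurveAt c' X t →
      IsMIntegralCurveAt c X t := by
    intro c c' t hc hc'
    filter_upwards [hc.eventuallyEq_nhds, hc'] with s hs hs'
    rw [hs.self_of_nhds]
    exact hs'.congr_of_eventuallyEq hs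
  refine ⟨min ε ε', lt_min hε hε', IsMIntegralCurveAt.isMIntegralCurveOn fun t ht => ?_⟩
  have h1 : -ε < t := by linarith [ht.1, min_le_left ε ε']
  have h2 : t < T + T' + ε' := by linarith [ht.2, min_le_right ε ε']
  rcases lt_trichotomy t T with hlt | rfl | hgt
  · refine congr_at (c' := γ) ?_ (hγ.isMIntegralCurveAt (Ioo_mem_nhds h1 (by linarith)))
    filter_upwards [Iio_mem_nhds hlt] with s hs
    exact if_pos (le_of_lt hs)
  · refine congr_at (c' := γ) ?_ (hγ.isMIntegralCurveAt (Ioo_mem_nhds h1 (by linarith)))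
    filter_upwards [hloc] with s hs
    split_ifs
    · rfl
    · exact hs.symm
  · refine congr_at (c' := fun t => γ' (t - T)) ?_ ?_
    · filter_upwards [Ioi_mem_nhds hgt] with s hs
      exact if_neg (not_le.2 hs)
    · have := (hγ'.isMIntegralCurveAt (t₀ := t + -T)
        (Ioo_mem_nhds (by linarith) (by linarith))).comp_add (-T)
      simpa [Function.comp_def, sub_eq_add_neg] using this

variable [T2Space M]

/-- Connectedness of `[0, T]`, applied to the open set of times near which the curves agree.
Regularity of the field is asked only along `γ`, because the push-forward to `D^*` is known to be
regular only at points of `Fl(S)`. -/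
theorem IsTrajectory.eqOn (hX : ∀ t ∈ Icc 0 T,
      ContMDiffAt J J.tangent 1 (fun x => (⟨x, X x⟩ : TangentBundle J M)) (γ t))
    (hγ : IsTrajectory X γ T) (hγ' : IsTrajectory X γ' T) (h0 : γ 0 = γ' 0) :
    EqOn γ γ' (Icc 0 T) := by
  intro t₁ ht₁
  have hT : (0 : ℝ) ∈ Icc 0 T := ⟨le_rfl, ht₁.1.trans ht₁.2⟩
  have key : ∀ t ∈ Icc 0 T, γ t = γ' t → γ =ᶠ[𝓝 t] γ' := fun t ht he =>
    isMIntegralCurveAt_eventuallyEq_of_contMDiffAt_boundaryless (hX t ht)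
      (hγ.isMIntegralCurveAt ht) (hγ'.isMIntegralCurveAt ht) he
  have hsub : Icc 0 T ⊆ {t | γ =ᶠ[𝓝 t] γ'} := by
    refine isPreconnected_Icc.subset_of_closure_inter_subset isOpen_setOfPred_eventually_nhds
      ⟨0, hT, key 0 hT h0⟩ ?_
    -- At a limit time the values agree by continuity and the Hausdorff property, and local
    -- uniqueness upgrades this to agreement nearby.
    rintro t ⟨htc, ht⟩
    refine key t ht ?_
    have hf : ∃ᶠ s in 𝓝 t, γ s = γ' s :=
      (mem_closure_iff_frequently.1 htc).mono fun s (hs : γ =ᶠ[𝓝 s] γ') => hs.self_of_nhds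
    exact tendsto_nhds_unique_of_frequently_eq (hγ.isMIntegralCurveAt ht).continuousAt
      (hγ'.isMIntegralCurveAt ht).continuousAt hf
  exact (hsub ht₁).self_of_nhds

theorem IsTrajectory.flow_eq (hX : ∀ t ∈ Icc 0 T,
      ContMDiffAt J J.tangent 1 (fun x => (⟨x, X x⟩ : TangentBundle J M)) (γ t))
    (hγ : IsTrajectory X γ T) {t : ℝ} (ht : t ∈ Icc 0 T) : flow X t (γ 0) = γ t := by
  have hm : γ 0 ∈ flowDomain X t := ⟨γ, rfl, hγ.mono ht.2⟩
  rw [flow, dif_pos hm]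
  exact (IsTrajectory.eqOn (fun s hs => hX s ⟨hs.1, hs.2.trans ht.2⟩) (hγ.mono ht.2)
    hm.choose_spec.2 hm.choose_spec.1.symm ⟨ht.1, le_rfl⟩).symm

end IntegralCurves

/-- Two points of one fibre are separated inside a single trivialization, points of different fibres
by their projections. It supplies the Hausdorff hypothesis of `IsTrajectory.eqOn` on `D` and on
`D^*`. -/
theorem totalSpace_t2Space {B F : Type*} [TopologicalSpace B] [T2Space B] [TopologicalSpace F]
    [T2Space F] (W : B → Type*) [TopologicalSpace (TotalSpace F W)] [∀ b, TopologicalSpace (W b)]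
    [FiberBundle F W] : T2Space (TotalSpace F W) := by
  refine ⟨fun x y hxy => ?_⟩
  by_cases h : x.proj = y.proj
  · set e := trivializationAt F W x.proj
    have hx : x ∈ e.source := e.mem_source.2 (mem_baseSet_trivializationAt F W x.proj)
    have hy : y ∈ e.source := e.mem_source.2 (h ▸ mem_baseSet_trivializationAt F W x.proj)
    have hne : e x ≠ e y := fun he => hxy (e.injOn hx hy he)
    obtain ⟨u, v, hu, hv, hxu, hyv, huv⟩ := t2_separation hne
    refine ⟨_, _, e.toOpenPartialHomeomorph.isOpen_inter_preimage hu,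
      e.toOpenPartialHomeomorph.isOpen_inter_preimage hv, ⟨hx, hxu⟩, ⟨hy, hyv⟩, ?_⟩
    exact (huv.preimage e).mono inter_subset_right inter_subset_right
  · exact separated_by_continuous (FiberBundle.continuous_proj F W) h

/-! ### Coordinate independence of the exterior derivative of a one-form. -/

section ExteriorDerivative

variable {V : Type*} [NormedAddCommGroup V] [NormedSpace ℝ V]
  {H : Type*} [TopologicalSpace H] {J : ModelWithCorners ℝ V H}
  {M : Type*} [TopologicalSpace M] [ChartedSpace H M]
  {Z : Type*} [NormedAddCommGroup Z] [NormedSpace ℝ Z]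

/-- The pull-back of a one-form by a parametrization. -/
def pullbackOneForm (ψ : Z → M) (θ : ∀ x : M, TangentSpace J x →L[ℝ] ℝ) (z : Z) : Z →L[ℝ] ℝ :=
  (θ (ψ z)).comp (mfderiv 𝓘(ℝ, Z) J ψ z)

theorem pullbackOneForm_comp_eventuallyEq {Z' : Type*} [NormedAddCommGroup Z'] [NormedSpace ℝ Z']
    {ψ : Z → M} {κ : Z' → M} {Ψ : Z' → Z} (θ : ∀ x : M, TangentSpace J x →L[ℝ] ℝ) {y : Z'}
    (hψ : ∀ᶠ z in 𝓝 (Ψ y), MDifferentiableAt 𝓘(ℝ, Z) J ψ z)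
    (hΨ : ContDiffAt ℝ 1 Ψ y) (h : ∀ᶠ y' in 𝓝 y, κ y' = ψ (Ψ y')) :
    pullbackOneForm κ θ =ᶠ[𝓝 y] fun y' => (pullbackOneForm ψ θ (Ψ y')).comp (fderiv ℝ Ψ y') := by
  filter_upwards [hΨ.continuousAt.eventually hψ, hΨ.eventually (by simp),
    Filter.EventuallyEq.eventuallyEq_nhds h] with y' h1 h2 h3
  have hd : mfderiv 𝓘(ℝ, Z') J κ y' =
      (mfderiv 𝓘(ℝ, Z) J ψ (Ψ y')).comp (fderiv ℝ Ψ y') := by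
    have e1 : HasMFDerivAt 𝓘(ℝ, Z') J κ y' _ := ((h1.hasMFDerivAt.comp y'
      (h2.differentiableAt one_ne_zero).hasFDerivAt.hasMFDerivAt).congr_of_eventuallyEq h3)
    exact e1.mfderiv
  ext w
  have hp : κ y' = ψ (Ψ y') := h3.self_of_nhds
  simp only [pullbackOneForm, ContinuousLinearMap.comp_apply]
  -- All tangent spaces are the model space `V` by definition, so the change of base point needs no
  -- cast.
  have hθ : ∀ (a b : M) (w : V), a = b → (θ a : V →L[ℝ] ℝ) w = (θ b : V →L[ℝ] ℝ) w := by
    rintro a b w rfl; rfl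
  refine (hθ _ _ _ hp).trans ?_
  exact congrArg (θ (ψ (Ψ y')) : V →L[ℝ] ℝ) (DFunLike.congr_fun hd w)

variable [IsManifold J 2 M] [J.Boundaryless]

/-- The exterior derivative can be computed in any local parametrization. -/
theorem extDerivOneForm_eq_pullback {ψ : Z → M} {g : M → Z}
    (θ : ∀ x : M, TangentSpace J x →L[ℝ] ℝ) {u : M} {z : Z} (hz : g u = z)
    (hψ : ∀ᶠ z' in 𝓝 z, MDifferentiableAt 𝓘(ℝ, Z) J ψ z')
    (hg : ContMDiffAt J 𝓘(ℝ, Z) 2 g u) (hψg : ∀ᶠ x in 𝓝 u, ψ (g x) = x)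
    (hθ : DifferentiableAt ℝ (pullbackOneForm ψ θ) z) (X Y : TangentSpace J u) :
    extDerivOneForm θ u X Y =
      fderiv ℝ (pullbackOneForm ψ θ) z (mfderiv J 𝓘(ℝ, Z) g u X) (mfderiv J 𝓘(ℝ, Z) g u Y)
      - fderiv ℝ (pullbackOneForm ψ θ) z
        (mfderiv J 𝓘(ℝ, Z) g u Y) (mfderiv J 𝓘(ℝ, Z) g u X) := by
  subst hz
  set κ := extChartAt J u with hκ
  set Ψ : V → Z := g ∘ κ.symm with hΨdef
  have hsymm : κ.symm (κ u) = u := extChartAt_to_inv u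
  have hκs : ContMDiffAt 𝓘(ℝ, V) J 2 κ.symm (κ u) :=
    (contMDiffOn_extChartAt_symm u).contMDiffAt (extChartAt_target_mem_nhds u)
  have hκc : ContMDiffAt J 𝓘(ℝ, V) 2 κ u := contMDiffAt_extChartAt
  have hΨ : ContDiffAt ℝ 2 Ψ (κ u) := by
    rw [← contMDiffAt_iff_contDiffAt]
    exact ContMDiffAt.comp (κ u) (by rwa [hsymm]) hκs
  have hΨu : Ψ (κ u) = g u := by simp only [hΨdef, Function.comp_apply, hsymm]
  have hloc : pullbackOneForm κ.symm θ =ᶠ[𝓝 (κ u)]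
      fun y' => (pullbackOneForm ψ θ (Ψ y')).comp (fderiv ℝ Ψ y') := by
    refine pullbackOneForm_comp_eventuallyEq θ (by rwa [hΨu]) (hΨ.of_le (by norm_num)) ?_
    have hc : Filter.Tendsto κ.symm (𝓝 (κ u)) (𝓝 u) := by
      simpa only [hsymm] using hκs.continuousAt.tendsto
    exact (hc.eventually hψg).mono fun y hy => hy.symm
  have hdg : ∀ W : TangentSpace J u, mfderiv J 𝓘(ℝ, Z) g u W =
      fderiv ℝ Ψ (κ u) (mfderiv J 𝓘(ℝ, V) κ u W) := by
    intro W
    have e1 : HasMFDerivAt J 𝓘(ℝ, Z) g u _ :=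
      (((hΨ.differentiableAt two_ne_zero).hasFDerivAt.hasMFDerivAt).comp u
        (hκc.mdifferentiableAt two_ne_zero).hasMFDerivAt).congr_of_eventuallyEq (by
          filter_upwards [extChartAt_source_mem_nhds (I := J) u] with x hx
          simp only [hΨdef, Function.comp_apply, hκ, (extChartAt J u).left_inv hx])
    rw [e1.mfderiv]; rfl
  have hd1 : HasFDerivAt (fun y => pullbackOneForm ψ θ (Ψ y))
      ((fderiv ℝ (pullbackOneForm ψ θ) (g u)).comp (fderiv ℝ Ψ (κ u))) (κ u) := by
    have := hθ.hasFDerivAt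
    rw [← hΨu] at this ⊢
    exact this.comp (κ u) (hΨ.differentiableAt two_ne_zero).hasFDerivAt
  have hd2 : HasFDerivAt (fderiv ℝ Ψ) (fderiv ℝ (fderiv ℝ Ψ) (κ u)) (κ u) :=
    ((hΨ.fderiv_right (m := 1) (by norm_num)).differentiableAt one_ne_zero).hasFDerivAt
  have hd := (hd1.clm_comp hd2).congr_of_eventuallyEq hloc
  have hsym : IsSymmSndFDerivAt ℝ Ψ (κ u) := hΨ.isSymmSndFDerivAt (by simp)
  have hgoal : extDerivOneForm θ u X Y =
      fderiv ℝ (pullbackOneForm κ.symm θ) (κ u)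
        (mfderiv J 𝓘(ℝ, V) κ u X) (mfderiv J 𝓘(ℝ, V) κ u Y)
      - fderiv ℝ (pullbackOneForm κ.symm θ) (κ u)
        (mfderiv J 𝓘(ℝ, V) κ u Y) (mfderiv J 𝓘(ℝ, V) κ u X) := rfl
  have aux : ∀ a b : V, fderiv ℝ (pullbackOneForm κ.symm θ) (κ u) a b
      - fderiv ℝ (pullbackOneForm κ.symm θ) (κ u) b a =
      fderiv ℝ (pullbackOneForm ψ θ) (g u) (fderiv ℝ Ψ (κ u) a) (fderiv ℝ Ψ (κ u) b)
      - fderiv ℝ (pullbackOneForm ψ θ) (g u) (fderiv ℝ Ψ (κ u) b) (fderiv ℝ Ψ (κ u) a) := by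
    intro a b
    rw [hd.fderiv]
    simp only [add_apply, ContinuousLinearMap.comp_apply,
      ContinuousLinearMap.compL_apply, ContinuousLinearMap.flip_apply]
    -- The product rule leaves terms containing the second derivative of the transition map `Ψ`;
    -- being symmetric, they cancel under antisymmetrization.
    rw [hsym a b]
    ring
  rw [hgoal, hdg X, hdg Y]
  exact aux _ _

end ExteriorDerivative

/-! ### Coordinates on a vector bundle from a base chart and a trivialization, both fixed at `q`. -/

section BundleCoordinates

set_option linter.unusedSectionVars false

variable {E : Type*} [NormedAddCommGroup E] [NormedSpace ℝ E]
  {Q : Type*} [TopologicalSpace Q] [ChartedSpace E Q]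
  {F : Type*} [NormedAddCommGroup F] [NormedSpace ℝ F]
  {W : Q → Type*} [TopologicalSpace (TotalSpace F W)] [∀ q, TopologicalSpace (W q)]
  [∀ q, AddCommGroup (W q)] [∀ q, Module ℝ (W q)] [FiberBundle F W] [VectorBundle ℝ F W]

/-- The local parametrization of a vector bundle by the chart of the base and the trivialization
at a point. -/
def bundleParam (q : Q) (z : E × F) : TotalSpace F W :=
  ⟨(chartAt E q).symm z.1, (trivializationAt F W q).symmL ℝ ((chartAt E q).symm z.1) z.2⟩

variable (E) in
/-- The local coordinates of a vector bundle given by the chart of the base and the trivialization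
at a point. -/
def bundleCoord (q : Q) (u : TotalSpace F W) : E × F :=
  (chartAt E q u.proj, (trivializationAt F W q).continuousLinearMapAt ℝ u.proj u.2)

variable (E F W) in
/-- The set of base coordinates on which `bundleParam` is a parametrization. -/
def paramDomain (q : Q) : Set E :=
  (chartAt E q).target ∩ (chartAt E q).symm ⁻¹' (trivializationAt F W q).baseSet

variable (E F W) in
/-- The set of base points over which `bundleCoord` are coordinates. -/
def coordDomain (q : Q) : Set Q :=
  (chartAt E q).source ∩ (trivializationAt F W q).baseSet

variable (F W) in
theorem isOpen_paramDomain (q : Q) : IsOpen (paramDomain E F W q) :=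
  (chartAt E q).isOpen_inter_preimage_symm (trivializationAt F W q).open_baseSet

variable (F W) in
theorem isOpen_coordDomain (q : Q) : IsOpen (coordDomain E F W q) :=
  (chartAt E q).open_source.inter (trivializationAt F W q).open_baseSet

variable (F W) in
theorem mem_coordDomain (q : Q) : q ∈ coordDomain E F W q :=
  ⟨mem_chart_source E q, mem_baseSet_trivializationAt F W q⟩

theorem coordDomain_of_paramDomain {q : Q} {x : E} (hx : x ∈ paramDomain E F W q) :
    (chartAt E q).symm x ∈ coordDomain E F W q :=
  ⟨(chartAt E q).map_target hx.1, hx.2⟩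

theorem paramDomain_of_coordDomain {q p : Q} (hp : p ∈ coordDomain E F W q) :
    chartAt E q p ∈ paramDomain E F W q :=
  ⟨(chartAt E q).map_source hp.1, by
    rw [mem_preimage, (chartAt E q).left_inv hp.1]; exact hp.2⟩

theorem bundleCoord_param {q : Q} {z : E × F} (hz : z.1 ∈ paramDomain E F W q) :
    bundleCoord E q (bundleParam q z : TotalSpace F W) = z :=
  Prod.ext ((chartAt E q).right_inv hz.1)
    ((trivializationAt F W q).continuousLinearMapAt_symmL (R := ℝ) hz.2 _)

theorem bundleParam_coord {q : Q} {u : TotalSpace F W} (hu : u.proj ∈ coordDomain E F W q) :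
    bundleParam q (bundleCoord E q u) = u := by
  have h1 : (chartAt E q).symm (chartAt E q u.proj) = u.proj := (chartAt E q).left_inv hu.1
  have h2 : ∀ p, p = u.proj → (⟨p, (trivializationAt F W q).symmL ℝ p
      ((trivializationAt F W q).continuousLinearMapAt ℝ u.proj u.2)⟩ : TotalSpace F W) = u := by
    rintro _ rfl
    rw [(trivializationAt F W q).symmL_continuousLinearMapAt (R := ℝ) hu.2]
  exact h2 _ h1

theorem eventually_paramDomain {q : Q} {z : E × F} (hz : z.1 ∈ paramDomain E F W q) :
    ∀ᶠ z' : E × F in 𝓝 z, z'.1 ∈ paramDomain E F W q :=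
  continuous_fst.continuousAt.eventually_mem ((isOpen_paramDomain F W q).mem_nhds hz)

theorem eventually_coordDomain {q : Q} {u : TotalSpace F W} (hu : u.proj ∈ coordDomain E F W q) :
    ∀ᶠ u' : TotalSpace F W in 𝓝 u, u'.proj ∈ coordDomain E F W q :=
  (FiberBundle.continuous_proj F W).continuousAt.eventually_mem
    ((isOpen_coordDomain F W q).mem_nhds hu)

variable [IsManifold 𝓘(ℝ, E) ∞ Q] [ContMDiffVectorBundle ∞ F W 𝓘(ℝ, E)]

theorem contMDiffAt_chart_symm {q : Q} {x : E} (hx : x ∈ (chartAt E q).target) :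
    ContMDiffAt 𝓘(ℝ, E) 𝓘(ℝ, E) ∞ (chartAt E q).symm x :=
  contMDiffOn_chart_symm.contMDiffAt ((chartAt E q).open_target.mem_nhds hx)

theorem contMDiffAt_chart {q p : Q} (hp : p ∈ (chartAt E q).source) :
    ContMDiffAt 𝓘(ℝ, E) 𝓘(ℝ, E) ∞ (chartAt E q) p :=
  contMDiffOn_chart.contMDiffAt ((chartAt E q).open_source.mem_nhds hp)

theorem contMDiffAt_bundleParam {q : Q} {z : E × F} (hz : z.1 ∈ paramDomain E F W q) :
    ContMDiffAt 𝓘(ℝ, E × F) (𝓘(ℝ, E).prod 𝓘(ℝ, F)) ∞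
      (bundleParam q : E × F → TotalSpace F W) z := by
  have hs : (bundleParam q z : TotalSpace F W) ∈ (trivializationAt F W q).source :=
    (trivializationAt F W q).mem_source.2 hz.2
  refine ((trivializationAt F W q).contMDiffAt_iff hs).2 ⟨?_, ?_⟩
  · exact (contMDiffAt_chart_symm hz.1).comp z contDiffAt_fst.contMDiffAt
  · refine contDiffAt_snd.contMDiffAt.congr_of_eventuallyEq ?_
    filter_upwards [eventually_paramDomain hz] with z' hz'
    have := congrArg Prod.snd (bundleCoord_param (W := W) hz')
    have hb : (bundleParam q z' : TotalSpace F W).proj ∈ (trivializationAt F W q).baseSet := hz'.2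
    rw [bundleCoord, Trivialization.continuousLinearMapAt_apply,
      Trivialization.linearMapAt_apply, if_pos hb] at this
    exact this

theorem contMDiffAt_bundleCoord {q : Q} {u : TotalSpace F W}
    (hu : u.proj ∈ coordDomain E F W q) :
    ContMDiffAt (𝓘(ℝ, E).prod 𝓘(ℝ, F)) 𝓘(ℝ, E × F) ∞
      (bundleCoord E q : TotalSpace F W → E × F) u := by
  refine ContMDiffAt.prodMk_space ?_ ?_
  · exact (contMDiffAt_chart hu.1).comp u (contMDiffAt_proj W)
  · have h := (((trivializationAt F W q).contMDiffAt_iff (IB := 𝓘(ℝ, E)) (n := ∞) (f := id)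
      ((trivializationAt F W q).mem_source.2 hu.2)).1 contMDiffAt_id).2
    refine h.congr_of_eventuallyEq ?_
    filter_upwards [eventually_coordDomain hu] with u' hu'
    rw [Trivialization.continuousLinearMapAt_apply,
      Trivialization.linearMapAt_apply, if_pos hu'.2]
    rfl

variable (W) in
/-- The derivative of `bundleParam`. -/
def dParam (q : Q) (z : E × F) :
    E × F →L[ℝ] TangentSpace (𝓘(ℝ, E).prod 𝓘(ℝ, F)) (bundleParam q z : TotalSpace F W) :=
  mfderiv 𝓘(ℝ, E × F) (𝓘(ℝ, E).prod 𝓘(ℝ, F)) (bundleParam q : E × F → TotalSpace F W) z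

theorem hasMFDerivAt_bundleParam {q : Q} {z : E × F} (hz : z.1 ∈ paramDomain E F W q) :
    HasMFDerivAt 𝓘(ℝ, E × F) (𝓘(ℝ, E).prod 𝓘(ℝ, F))
      (bundleParam q : E × F → TotalSpace F W) z (dParam W q z) :=
  ((contMDiffAt_bundleParam hz).mdifferentiableAt (by simp)).hasMFDerivAt

theorem mfderiv_bundleCoord_dParam {q : Q} {z : E × F} (hz : z.1 ∈ paramDomain E F W q)
    (X : E × F) : mfderiv (𝓘(ℝ, E).prod 𝓘(ℝ, F)) 𝓘(ℝ, E × F) (bundleCoord E q)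
      (bundleParam q z : TotalSpace F W) (dParam W q z X) = X := by
  have h1 := ((contMDiffAt_bundleCoord (W := W)
    (coordDomain_of_paramDomain hz : (bundleParam q z : TotalSpace F W).proj ∈ _)).mdifferentiableAt
      (by simp)).hasMFDerivAt.comp z (hasMFDerivAt_bundleParam hz)
  have h2 : HasMFDerivAt 𝓘(ℝ, E × F) 𝓘(ℝ, E × F)
      (bundleCoord E q ∘ (bundleParam q : E × F → TotalSpace F W)) z
      (ContinuousLinearMap.id ℝ (E × F)) := by
    refine (hasMFDerivAt_id z).congr_of_eventuallyEq ?_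
    filter_upwards [eventually_paramDomain hz] with z' hz'
    exact bundleCoord_param hz'
  exact DFunLike.congr_fun (hasMFDerivAt_unique h1 h2) X

theorem dParam_mfderiv_bundleCoord {q : Q} {z : E × F} (hz : z.1 ∈ paramDomain E F W q)
    (X : TangentSpace (𝓘(ℝ, E).prod 𝓘(ℝ, F)) (bundleParam q z : TotalSpace F W)) :
    dParam W q z (mfderiv (𝓘(ℝ, E).prod 𝓘(ℝ, F)) 𝓘(ℝ, E × F) (bundleCoord E q)
      (bundleParam q z : TotalSpace F W) X) = X := by
  have hud : (bundleParam q z : TotalSpace F W).proj ∈ coordDomain E F W q :=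
    coordDomain_of_paramDomain hz
  have hp : HasMFDerivAt 𝓘(ℝ, E × F) (𝓘(ℝ, E).prod 𝓘(ℝ, F))
      (bundleParam q : E × F → TotalSpace F W) (bundleCoord E q (bundleParam q z : TotalSpace F W))
      (dParam W q z) := by
    rw [bundleCoord_param hz]; exact hasMFDerivAt_bundleParam hz
  have h1 := hp.comp (bundleParam q z : TotalSpace F W)
    ((contMDiffAt_bundleCoord (W := W) hud).mdifferentiableAt (by simp)).hasMFDerivAt
  have h2 : HasMFDerivAt (𝓘(ℝ, E).prod 𝓘(ℝ, F)) (𝓘(ℝ, E).prod 𝓘(ℝ, F))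
      ((bundleParam q : E × F → TotalSpace F W) ∘ bundleCoord E q) (bundleParam q z : TotalSpace F W)
      (ContinuousLinearMap.id ℝ _) := by
    refine (hasMFDerivAt_id _).congr_of_eventuallyEq ?_
    filter_upwards [eventually_coordDomain (W := W) hud] with u' hu'
    exact bundleParam_coord hu'
  exact DFunLike.congr_fun (hasMFDerivAt_unique h1 h2) X

theorem dParam_injective {q : Q} {z : E × F} (hz : z.1 ∈ paramDomain E F W q) :
    Function.Injective (dParam W q z) :=
  Function.LeftInverse.injective (mfderiv_bundleCoord_dParam hz)

theorem dParam_surjective {q : Q} {z : E × F} (hz : z.1 ∈ paramDomain E F W q) :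
    Function.Surjective (dParam W q z) :=
  Function.RightInverse.surjective (dParam_mfderiv_bundleCoord hz)

end BundleCoordinates

/-! ### The vertical lift and the vertical endomorphism in coordinates. -/

section TangentCoordinates

variable {E : Type*} [NormedAddCommGroup E] [NormedSpace ℝ E]
  {Q : Type*} [TopologicalSpace Q] [ChartedSpace E Q] [IsManifold 𝓘(ℝ, E) ∞ Q]

variable (E) in
/-- The local parametrization of the tangent bundle at a base point. -/
abbrev tangentParam (q : Q) (z : E × E) : TangentBundle 𝓘(ℝ, E) Q :=
  bundleParam (F := E) (W := fun p : Q => TangentSpace 𝓘(ℝ, E) p) q z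

/-- The derivative of `tangentParam`. -/
abbrev dTangentParam (q : Q) (z : E × E) :
    E × E →L[ℝ] TangentSpace (𝓘(ℝ, E).tangent) (tangentParam E q z) :=
  dParam (F := E) (fun p : Q => TangentSpace 𝓘(ℝ, E) p) q z

variable (E) in
/-- The base coordinates for `tangentParam`. -/
abbrev tangentDomain (q : Q) : Set E :=
  paramDomain E E (fun p : Q => TangentSpace 𝓘(ℝ, E) p) q

variable {q : Q} {z : E × E}

/-- The trivialization of `TQ` at `q` is the derivative of the chart at `q`, so `tangentParam` gives
the natural coordinates `(x, ẋ)`. This is what makes the vertical endomorphism `(a, b) ↦ (0, a)`. -/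
theorem continuousLinearMapAt_mfderiv_chart_symm {x : E} (hx : x ∈ tangentDomain E q) (a : E) :
    (trivializationAt E (fun p : Q => TangentSpace 𝓘(ℝ, E) p) q).continuousLinearMapAt ℝ
      ((chartAt E q).symm x) (mfderiv 𝓘(ℝ, E) 𝓘(ℝ, E) (chartAt E q).symm x a) = a := by
  have hs : (chartAt E q).symm x ∈ (chartAt E q).source := (chartAt E q).map_target hx.1
  have h0 := TangentBundle.continuousLinearMapAt_trivializationAt (I := 𝓘(ℝ, E)) hs
  have h1 := ((contMDiffAt_chart hs).mdifferentiableAt (by simp)).hasMFDerivAt.comp x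
    ((contMDiffAt_chart_symm hx.1).mdifferentiableAt (by simp)).hasMFDerivAt
  have h2 : HasMFDerivAt 𝓘(ℝ, E) 𝓘(ℝ, E) (chartAt E q ∘ (chartAt E q).symm) x
      (ContinuousLinearMap.id ℝ E) := by
    refine (hasMFDerivAt_id x).congr_of_eventuallyEq ?_
    filter_upwards [(chartAt E q).open_target.mem_nhds hx.1] with y hy
    exact (chartAt E q).right_inv hy
  rw [h0]
  exact DFunLike.congr_fun (hasMFDerivAt_unique h1 h2) a

theorem mfderiv_proj_dTangentParam (hz : z.1 ∈ tangentDomain E q) (X : E × E) :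
    mfderiv (𝓘(ℝ, E).tangent) 𝓘(ℝ, E) (fun v : TangentBundle 𝓘(ℝ, E) Q => v.proj)
      (tangentParam E q z) (dTangentParam q z X)
      = mfderiv 𝓘(ℝ, E) 𝓘(ℝ, E) (chartAt E q).symm z.1 X.1 := by
  have h1 := (((contMDiff_proj (n := ∞) (fun p : Q => TangentSpace 𝓘(ℝ, E) p)).mdifferentiableAt
    (x := tangentParam E q z) (by simp)).hasMFDerivAt).comp z (hasMFDerivAt_bundleParam hz)
  have h2 := ((contMDiffAt_chart_symm hz.1).mdifferentiableAt (by simp)).hasMFDerivAt.comp z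
    (hasFDerivAt_fst (𝕜 := ℝ) (p := z)).hasMFDerivAt
  exact DFunLike.congr_fun (hasMFDerivAt_unique h1 h2) X

theorem verticalLift_tangentParam (hz : z.1 ∈ tangentDomain E q)
    (w : TangentSpace 𝓘(ℝ, E) (tangentParam E q z).proj) :
    verticalLift (tangentParam E q z) w = dTangentParam q z
      (0, (trivializationAt E (fun p : Q => TangentSpace 𝓘(ℝ, E) p) q).continuousLinearMapAt ℝ
        (tangentParam E q z).proj w) := by
  set C : E →L[ℝ] E := (trivializationAt E
    (fun p : Q => TangentSpace 𝓘(ℝ, E) p) q).continuousLinearMapAt ℝ (tangentParam E q z).proj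
  have hC : C (tangentParam E q z).2 = z.2 :=
    congrArg Prod.snd (bundleCoord_param (W := fun p : Q => TangentSpace 𝓘(ℝ, E) p) hz)
  -- In coordinates, the inclusion of a fibre of `TQ` is the affine map `w ↦ (z.1, C w)`.
  have hfun : (fun w : E => (⟨(tangentParam E q z).proj, w⟩ : TangentBundle 𝓘(ℝ, E) Q)) =
      tangentParam E q ∘ fun w => (z.1, C w) := by
    funext w
    refine congrArg (TotalSpace.mk (F := E) (tangentParam E q z).proj) ?_
    exact ((trivializationAt E (fun p : Q => TangentSpace 𝓘(ℝ, E) p) q).symmL_continuousLinearMapAt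
      (R := ℝ) hz.2 w).symm
  have aux : ∀ y : E, C y = z.2 → mfderiv 𝓘(ℝ, E) (𝓘(ℝ, E).tangent)
      (fun w : E => (⟨(tangentParam E q z).proj, w⟩ : TangentBundle 𝓘(ℝ, E) Q)) y =
      (dTangentParam q z).comp ((0 : E →L[ℝ] E).prod C) := by
    intro y hy
    have h1 : HasFDerivAt (fun w : E => (z.1, C w)) ((0 : E →L[ℝ] E).prod C) y :=
      (hasFDerivAt_const _ _).prodMk C.hasFDerivAt
    have h2 : HasMFDerivAt 𝓘(ℝ, E × E) (𝓘(ℝ, E).tangent) (tangentParam E q)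
        (z.1, C y) (dTangentParam q z) := by
      rw [hy]; exact hasMFDerivAt_bundleParam hz
    rw [hfun]
    exact (h2.comp y h1.hasMFDerivAt).mfderiv
  exact DFunLike.congr_fun (aux _ hC) w

theorem verticalEndomorphism_dTangentParam (hz : z.1 ∈ tangentDomain E q) (X : E × E) :
    verticalEndomorphism (tangentParam E q z) (dTangentParam q z X)
      = dTangentParam q z (0, X.1) := by
  have h1 := congrArg (verticalLift (tangentParam E q z)) (mfderiv_proj_dTangentParam hz X)
  refine h1.trans ((verticalLift_tangentParam hz _).trans ?_)
  exact congrArg (fun a : E => dTangentParam q z (0, a))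
    (continuousLinearMapAt_mfderiv_chart_symm hz X.1)

end TangentCoordinates

/-! ### The Cartan forms and the energy in coordinates. -/

section LagrangianCoordinates

theorem mfderiv_dParam
    {E : Type*} [NormedAddCommGroup E] [NormedSpace ℝ E]
    {Q : Type*} [TopologicalSpace Q] [ChartedSpace E Q] [IsManifold 𝓘(ℝ, E) ∞ Q]
    {F : Type*} [NormedAddCommGroup F] [NormedSpace ℝ F]
    {W : Q → Type*} [TopologicalSpace (TotalSpace F W)] [∀ q, TopologicalSpace (W q)]
    [∀ q, AddCommGroup (W q)] [∀ q, Module ℝ (W q)] [FiberBundle F W] [VectorBundle ℝ F W]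
    [ContMDiffVectorBundle ∞ F W 𝓘(ℝ, E)] {G : Type*} [NormedAddCommGroup G] [NormedSpace ℝ G]
    {q : Q} {z : E × F} (hz : z.1 ∈ paramDomain E F W q) {f : TotalSpace F W → G}
    (hf : DifferentiableAt ℝ (fun z : E × F => f (bundleParam q z)) z) (X : E × F) :
    mfderiv (𝓘(ℝ, E).prod 𝓘(ℝ, F)) 𝓘(ℝ, G) f (bundleParam q z) (dParam W q z X)
      = fderiv ℝ (fun z : E × F => f (bundleParam q z)) z X := by
  have hu : (bundleParam q z : TotalSpace F W).proj ∈ coordDomain E F W q :=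
    coordDomain_of_paramDomain hz
  have hf' : HasMFDerivAt 𝓘(ℝ, E × F) 𝓘(ℝ, G) (fun z : E × F => f (bundleParam q z))
      (bundleCoord E q (bundleParam q z : TotalSpace F W))
      (fderiv ℝ (fun z : E × F => f (bundleParam q z)) z) := by
    rw [bundleCoord_param hz]; exact hf.hasFDerivAt.hasMFDerivAt
  have h1 := (hf'.comp (bundleParam q z : TotalSpace F W)
    ((contMDiffAt_bundleCoord (W := W) hu).mdifferentiableAt (by simp)).hasMFDerivAt)
  have h2 : HasMFDerivAt (𝓘(ℝ, E).prod 𝓘(ℝ, F)) 𝓘(ℝ, G) f (bundleParam q z) _ :=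
    h1.congr_of_eventuallyEq (by
      filter_upwards [eventually_coordDomain (W := W) hu] with u' hu'
      simp only [Function.comp_apply, bundleParam_coord hu'])
  rw [h2.mfderiv]
  exact congrArg (fderiv ℝ (fun z : E × F => f (bundleParam q z)) z)
    (mfderiv_bundleCoord_dParam hz X)

variable {E : Type*} [NormedAddCommGroup E] [NormedSpace ℝ E]
  {Q : Type*} [TopologicalSpace Q] [ChartedSpace E Q] [IsManifold 𝓘(ℝ, E) ∞ Q]
  (L : TangentBundle 𝓘(ℝ, E) Q → ℝ) {q : Q} {z : E × E}

/-- The Lagrangian in local coordinates. -/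
def localLagrangian (q : Q) (z : E × E) : ℝ := L (tangentParam E q z)

/-- The second derivative of the Lagrangian in local coordinates. -/
def localHessian (q : Q) (z : E × E) : E × E →L[ℝ] E × E →L[ℝ] ℝ :=
  fderiv ℝ (fderiv ℝ (localLagrangian L q)) z

variable {L}

theorem contDiffAt_localLagrangian (hL : ContMDiff (𝓘(ℝ, E).tangent) 𝓘(ℝ, ℝ) ∞ L)
    (hz : z.1 ∈ tangentDomain E q) : ContDiffAt ℝ ∞ (localLagrangian L q) z := by
  rw [← contMDiffAt_iff_contDiffAt]
  exact (hL.contMDiffAt (x := tangentParam E q z)).comp z (contMDiffAt_bundleParam hz)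

theorem hasFDerivAt_fderiv_localLagrangian (hL : ContMDiff (𝓘(ℝ, E).tangent) 𝓘(ℝ, ℝ) ∞ L)
    (hz : z.1 ∈ tangentDomain E q) :
    HasFDerivAt (fderiv ℝ (localLagrangian L q)) (localHessian L q z) z :=
  (((contDiffAt_localLagrangian hL hz).fderiv_right (m := 1) (by norm_cast)).differentiableAt
    one_ne_zero).hasFDerivAt

theorem localHessian_symm (hL : ContMDiff (𝓘(ℝ, E).tangent) 𝓘(ℝ, ℝ) ∞ L)
    (hz : z.1 ∈ tangentDomain E q) (X Y : E × E) :
    localHessian L q z X Y = localHessian L q z Y X :=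
  (contDiffAt_localLagrangian hL hz).isSymmSndFDerivAt
    (by simp only [minSmoothness_of_isRCLikeNormedField]; norm_cast) X Y

theorem differential_dTangentParam (hL : ContMDiff (𝓘(ℝ, E).tangent) 𝓘(ℝ, ℝ) ∞ L)
    (hz : z.1 ∈ tangentDomain E q) (X : E × E) :
    differential (𝓘(ℝ, E).tangent) L (tangentParam E q z) (dTangentParam q z X)
      = fderiv ℝ (localLagrangian L q) z X :=
  mfderiv_dParam hz ((contDiffAt_localLagrangian hL hz).differentiableAt (by simp)) X

theorem pullback_cartanOneForm (hL : ContMDiff (𝓘(ℝ, E).tangent) 𝓘(ℝ, ℝ) ∞ L)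
    (hz : z.1 ∈ tangentDomain E q) :
    pullbackOneForm (J := 𝓘(ℝ, E).tangent) (tangentParam E q) (cartanOneForm L) z =
      (fderiv ℝ (localLagrangian L q) z).comp
        ((ContinuousLinearMap.inr ℝ E E).comp (ContinuousLinearMap.fst ℝ E E)) := by
  refine ContinuousLinearMap.ext fun X => ?_
  have h1 := congrArg (differential (𝓘(ℝ, E).tangent) L (tangentParam E q z))
    (verticalEndomorphism_dTangentParam hz X)
  exact h1.trans (differential_dTangentParam hL hz _)

/-- In coordinates the Cartan one-form is `∂ℓ/∂y · dx`, whose exterior derivative involves only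
second derivatives of `ℓ`. -/
theorem cartanTwoForm_dTangentParam (hL : ContMDiff (𝓘(ℝ, E).tangent) 𝓘(ℝ, ℝ) ∞ L)
    (hz : z.1 ∈ tangentDomain E q) (X Y : E × E) :
    cartanTwoForm L (tangentParam E q z) (dTangentParam q z X) (dTangentParam q z Y) =
      localHessian L q z Y (0, X.1) - localHessian L q z X (0, Y.1) := by
  have hloc : pullbackOneForm (J := 𝓘(ℝ, E).tangent) (tangentParam E q) (cartanOneForm L) =ᶠ[𝓝 z]
      fun z => (fderiv ℝ (localLagrangian L q) z).comp
        ((ContinuousLinearMap.inr ℝ E E).comp (ContinuousLinearMap.fst ℝ E E)) := by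
    filter_upwards [eventually_paramDomain hz] with z' hz'
    exact pullback_cartanOneForm hL hz'
  have hd := ((hasFDerivAt_fderiv_localLagrangian hL hz).clm_comp
    (hasFDerivAt_const ((ContinuousLinearMap.inr ℝ E E).comp
      (ContinuousLinearMap.fst ℝ E E)) z)).congr_of_eventuallyEq hloc
  have hu : (tangentParam E q z).proj ∈ coordDomain E E (fun p : Q => TangentSpace 𝓘(ℝ, E) p) q :=
    coordDomain_of_paramDomain hz
  have key := extDerivOneForm_eq_pullback (J := 𝓘(ℝ, E).tangent) (ψ := tangentParam E q)
    (g := bundleCoord E q) (cartanOneForm L) (bundleCoord_param hz)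
    ((eventually_paramDomain hz).mono fun z' hz' =>
      (contMDiffAt_bundleParam hz').mdifferentiableAt (by simp))
    ((contMDiffAt_bundleCoord hu).of_le (by norm_cast))
    ((eventually_coordDomain hu).mono fun u' hu' => bundleParam_coord hu')
    hd.differentiableAt (dTangentParam q z X) (dTangentParam q z Y)
  have hX := mfderiv_bundleCoord_dParam (W := fun p : Q => TangentSpace 𝓘(ℝ, E) p) hz
  have aux : ∀ X' Y' : E × E, X' = X → Y' = Y →
      fderiv ℝ (pullbackOneForm (J := 𝓘(ℝ, E).tangent) (tangentParam E q) (cartanOneForm L)) z X' Y'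
      - fderiv ℝ (pullbackOneForm (J := 𝓘(ℝ, E).tangent) (tangentParam E q) (cartanOneForm L)) z
        Y' X' = localHessian L q z X (0, Y.1) - localHessian L q z Y (0, X.1) := by
    rintro _ _ rfl rfl
    rw [hd.fderiv]
    simp
  rw [cartanTwoForm, key, aux _ _ (hX X) (hX Y)]
  ring

theorem energy_tangentParam (hL : ContMDiff (𝓘(ℝ, E).tangent) 𝓘(ℝ, ℝ) ∞ L)
    (hz : z.1 ∈ tangentDomain E q) :
    energy L (tangentParam E q z) =
      fderiv ℝ (localLagrangian L q) z (0, z.2) - localLagrangian L q z := by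
  have h1 := congrArg (differential (𝓘(ℝ, E).tangent) L (tangentParam E q z))
    (verticalLift_tangentParam hz (tangentParam E q z).2)
  have h2 := congrArg Prod.snd (bundleCoord_param (W := fun p : Q => TangentSpace 𝓘(ℝ, E) p) hz)
  have h3 := h1.trans (differential_dTangentParam hL hz _)
  have h4 := h3.trans (congrArg (fun a : E => fderiv ℝ (localLagrangian L q) z (0, a)) h2)
  exact congrArg (· - L (tangentParam E q z)) h4

theorem differential_energy_dTangentParam (hL : ContMDiff (𝓘(ℝ, E).tangent) 𝓘(ℝ, ℝ) ∞ L)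
    (hz : z.1 ∈ tangentDomain E q) (Y : E × E) :
    differential (𝓘(ℝ, E).tangent) (energy L) (tangentParam E q z) (dTangentParam q z Y) =
      localHessian L q z Y (0, z.2) - fderiv ℝ (localLagrangian L q) z (Y.1, 0) := by
  have hloc : (fun z => energy L (tangentParam E q z)) =ᶠ[𝓝 z] fun z =>
      fderiv ℝ (localLagrangian L q) z (0, z.2) - localLagrangian L q z := by
    filter_upwards [eventually_paramDomain hz] with z' hz'
    exact energy_tangentParam hL hz'
  have hv : HasFDerivAt (fun z : E × E => ((0 : E), z.2))
      ((ContinuousLinearMap.inr ℝ E E).comp (ContinuousLinearMap.snd ℝ E E)) z :=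
    ((ContinuousLinearMap.inr ℝ E E).comp (ContinuousLinearMap.snd ℝ E E)).hasFDerivAt
  have hd := (((hasFDerivAt_fderiv_localLagrangian hL hz).clm_apply hv).sub
    ((contDiffAt_localLagrangian hL hz).differentiableAt
      (by simp)).hasFDerivAt).congr_of_eventuallyEq hloc
  have h1 := mfderiv_dParam (W := fun p : Q => TangentSpace 𝓘(ℝ, E) p) (f := energy L) hz
    hd.differentiableAt Y
  refine Eq.trans h1 ?_
  rw [hd.fderiv]
  -- Splitting `Y` exposes the two terms `∂ℓ/∂y · Y.2`, one from differentiating `y` in `∂ℓ/∂y · y`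
  -- and one from `-ℓ`; they cancel.
  have hY : Y = (Y.1, 0) + (0, Y.2) := by simp
  have := congrArg (fderiv ℝ (localLagrangian L q) z) hY
  rw [map_add] at this
  simp only [this, add_apply, sub_apply, ContinuousLinearMap.comp_apply,
    ContinuousLinearMap.flip_apply, ContinuousLinearMap.inr_apply, ContinuousLinearMap.coe_snd']
  ring

end LagrangianCoordinates

/-! ### Frames at points equal to a coordinate point, and nondegeneracy of the vertical Hessian. -/

section Frame

variable {E : Type*} [NormedAddCommGroup E] [NormedSpace ℝ E]
  {Q : Type*} [TopologicalSpace Q] [ChartedSpace E Q] [IsManifold 𝓘(ℝ, E) ∞ Q]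
  {L : TangentBundle 𝓘(ℝ, E) Q → ℝ} {q : Q} {z : E × E}

/-- The derivative of `tangentParam` at `z`, with values in the tangent space at a point known to
be equal to `tangentParam E q z`. -/
def frameAt (q : Q) (z : E × E) (u : TangentBundle 𝓘(ℝ, E) Q) :
    E × E →L[ℝ] TangentSpace (𝓘(ℝ, E).tangent) u := dTangentParam q z

variable {u : TangentBundle 𝓘(ℝ, E) Q}

/-- Along `D` the point `𝒟.toTangent (bundleParam q z)` equals a coordinate point only
propositionally. Stating these facts for a variable `u` with `hu` confines the transport to a
`subst`. -/
theorem frameAt_bijective (hu : u = tangentParam E q z) (hz : z.1 ∈ tangentDomain E q) :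
    Function.Bijective (frameAt q z u) := by
  subst hu
  exact ⟨dParam_injective hz, dParam_surjective hz⟩

theorem verticalEndomorphism_frameAt (hu : u = tangentParam E q z) (hz : z.1 ∈ tangentDomain E q)
    (X : E × E) : verticalEndomorphism u (frameAt q z u X) = frameAt q z u (0, X.1) := by
  subst hu
  exact verticalEndomorphism_dTangentParam hz X

theorem cartanTwoForm_frameAt (hL : ContMDiff (𝓘(ℝ, E).tangent) 𝓘(ℝ, ℝ) ∞ L)
    (hu : u = tangentParam E q z) (hz : z.1 ∈ tangentDomain E q) (X Y : E × E) :
    cartanTwoForm L u (frameAt q z u X) (frameAt q z u Y) =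
      localHessian L q z Y (0, X.1) - localHessian L q z X (0, Y.1) := by
  subst hu
  exact cartanTwoForm_dTangentParam hL hz X Y

theorem differential_energy_frameAt (hL : ContMDiff (𝓘(ℝ, E).tangent) 𝓘(ℝ, ℝ) ∞ L)
    (hu : u = tangentParam E q z) (hz : z.1 ∈ tangentDomain E q) (Y : E × E) :
    differential (𝓘(ℝ, E).tangent) (energy L) u (frameAt q z u Y) =
      localHessian L q z Y (0, z.2) - fderiv ℝ (localLagrangian L q) z (Y.1, 0) := by
  subst hu
  exact differential_energy_dTangentParam hL hz Y

/-- The fibre coordinate change `C` is linear, so the two vertical Hessians differ by a congruence,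
with no first-derivative terms. -/
theorem IsRegularLagrangian.localHessian_nondegenerate (h : IsRegularLagrangian L)
    (hL : ContMDiff (𝓘(ℝ, E).tangent) 𝓘(ℝ, ℝ) ∞ L) (hz : z.1 ∈ tangentDomain E q) (a : E)
    (ha : ∀ b, localHessian L q z (0, a) (0, b) = 0) : a = 0 := by
  set p : Q := (chartAt E q).symm z.1 with hp
  set e := trivializationAt E (fun p : Q => TangentSpace 𝓘(ℝ, E) p) q with he
  set C : E →L[ℝ] E := e.continuousLinearMapAt ℝ p with hCdef
  set C' : E →L[ℝ] E := e.symmL ℝ p with hC'def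
  have hC : ∀ w, C (C' w) = w := fun w => e.continuousLinearMapAt_symmL (R := ℝ) hz.2 w
  have hC' : ∀ w, C' (C w) = w := fun w => e.symmL_continuousLinearMapAt (R := ℝ) hz.2 w
  have hfun : (fun w : E => L (⟨p, w⟩ : TangentBundle 𝓘(ℝ, E) Q)) =
      fun w => localLagrangian L q (z.1, C w) := by
    funext w
    exact congrArg (fun w : E => L (⟨p, w⟩ : TangentBundle 𝓘(ℝ, E) Q)) (hC' w).symm
  have hι : ∀ w, HasFDerivAt (fun w : E => (z.1, C w)) ((ContinuousLinearMap.inr ℝ E E).comp C) w :=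
    fun w => (hasFDerivAt_const z.1 w).prodMk C.hasFDerivAt
  have h1 : ∀ w, fderiv ℝ (fun w : E => L (⟨p, w⟩ : TangentBundle 𝓘(ℝ, E) Q)) w =
      (fderiv ℝ (localLagrangian L q) (z.1, C w)).comp ((ContinuousLinearMap.inr ℝ E E).comp C) := by
    intro w
    rw [hfun]
    have := ((contDiffAt_localLagrangian (z := (z.1, C w)) hL hz).differentiableAt
      (by simp)).hasFDerivAt
    exact (this.comp w (hι w)).fderiv
  have h2 : fderiv ℝ (fun w => fderiv ℝ
      (fun w : E => L (⟨p, w⟩ : TangentBundle 𝓘(ℝ, E) Q)) w) (C' z.2) =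
      ((ContinuousLinearMap.compL ℝ E (E × E) ℝ).flip ((ContinuousLinearMap.inr ℝ E E).comp C)).comp
        ((localHessian L q z).comp ((ContinuousLinearMap.inr ℝ E E).comp C)) := by
    simp only [h1]
    have h3 : HasFDerivAt (fderiv ℝ (localLagrangian L q)) (localHessian L q z)
        (z.1, C (C' z.2)) := by
      rw [hC]; exact hasFDerivAt_fderiv_localLagrangian hL hz
    exact (((ContinuousLinearMap.compL ℝ E (E × E) ℝ).flip
      ((ContinuousLinearMap.inr ℝ E E).comp C)).hasFDerivAt.comp (C' z.2)
        (h3.comp (C' z.2) (hι _))).fderiv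
  have h4 := h p (C' z.2) (C' a) (fun b => by
    rw [h2]
    simpa [hC] using ha (C b))
  rw [← hC a, h4, map_zero]

end Frame

/-! ### The inclusion of the distribution in coordinates. -/

section Distributions

set_option linter.unusedSectionVars false

variable {E : Type*} [NormedAddCommGroup E] [NormedSpace ℝ E]
  {Q : Type*} [TopologicalSpace Q] [ChartedSpace E Q] [IsManifold 𝓘(ℝ, E) ∞ Q]
  {F : Type*} [NormedAddCommGroup F] [NormedSpace ℝ F]
  {D : Q → Type*} [TopologicalSpace (TotalSpace F D)] [∀ q, TopologicalSpace (D q)]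
  [∀ q, AddCommGroup (D q)] [∀ q, Module ℝ (D q)] [FiberBundle F D] [VectorBundle ℝ F D]
  {L : TangentBundle 𝓘(ℝ, E) Q → ℝ} (𝒟 : Distribution E F D) {q : Q} {z : E × F}

theorem paramDomain_subset_tangentDomain (q : Q) :
    paramDomain E F D q ⊆ tangentDomain E q :=
  fun _ hx => ⟨hx.1, (chartAt E q).map_target hx.1⟩

/-- The inclusion of a distribution in local coordinates. -/
def Distribution.localIncl (q : Q) (z : E × F) : E × E :=
  bundleCoord E q (𝒟.toTangent (bundleParam q z))

/-- The fibre part of the inclusion of a distribution in local coordinates. -/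
def Distribution.localFibreIncl (q : Q) (x : E) : F →L[ℝ] E :=
  ((trivializationAt E (fun p : Q => TangentSpace 𝓘(ℝ, E) p) q).continuousLinearMapAt ℝ
    ((chartAt E q).symm x)).comp ((𝒟.incl ((chartAt E q).symm x)).comp
      ((trivializationAt F D q).symmL ℝ ((chartAt E q).symm x)))

theorem Distribution.localIncl_eq (hz : z.1 ∈ paramDomain E F D q) :
    𝒟.localIncl q z = (z.1, 𝒟.localFibreIncl q z.1 z.2) :=
  Prod.ext ((chartAt E q).right_inv hz.1) rfl

theorem Distribution.localIncl_fst_mem (hz : z.1 ∈ paramDomain E F D q) :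
    (𝒟.localIncl q z).1 ∈ tangentDomain E q := by
  rw [𝒟.localIncl_eq hz]
  exact paramDomain_subset_tangentDomain q hz

theorem Distribution.toTangent_bundleParam (hz : z.1 ∈ paramDomain E F D q) :
    𝒟.toTangent (bundleParam q z) = tangentParam E q (𝒟.localIncl q z) :=
  (bundleParam_coord (coordDomain_of_paramDomain
    (W := fun p : Q => TangentSpace 𝓘(ℝ, E) p) (paramDomain_subset_tangentDomain q hz))).symm

theorem Distribution.localFibreIncl_injective (hz : z.1 ∈ paramDomain E F D q) :
    Function.Injective (𝒟.localFibreIncl q z.1) := by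
  have h1 : Function.Injective ((trivializationAt E (fun p : Q =>
      TangentSpace 𝓘(ℝ, E) p) q).continuousLinearMapAt ℝ ((chartAt E q).symm z.1)) :=
    Function.LeftInverse.injective ((trivializationAt E (fun p : Q =>
      TangentSpace 𝓘(ℝ, E) p) q).symmL_continuousLinearMapAt (R := ℝ)
        (paramDomain_subset_tangentDomain q hz).2)
  have h2 : Function.Injective ((trivializationAt F D q).symmL ℝ ((chartAt E q).symm z.1)) :=
    Function.LeftInverse.injective
      ((trivializationAt F D q).continuousLinearMapAt_symmL (R := ℝ) hz.2)
  exact h1.comp ((𝒟.incl_injective _).comp h2)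

variable [ContMDiffVectorBundle ∞ F D 𝓘(ℝ, E)]

theorem Distribution.contDiffAt_localIncl (hz : z.1 ∈ paramDomain E F D q) :
    ContDiffAt ℝ ∞ (𝒟.localIncl q) z := by
  rw [← contMDiffAt_iff_contDiffAt]
  have h1 : ContMDiffAt 𝓘(ℝ, E × F) 𝓘(ℝ, E).tangent ∞
      (fun z : E × F => 𝒟.toTangent (bundleParam q z)) z :=
    (𝒟.contMDiff_incl.contMDiffAt (x := bundleParam q z)).comp z (contMDiffAt_bundleParam hz)
  exact (contMDiffAt_bundleCoord (coordDomain_of_paramDomain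
    (W := fun p : Q => TangentSpace 𝓘(ℝ, E) p)
      (paramDomain_subset_tangentDomain q hz))).comp z h1

theorem Distribution.hasFDerivAt_localIncl (hz : z.1 ∈ paramDomain E F D q) :
    HasFDerivAt (𝒟.localIncl q) (fderiv ℝ (𝒟.localIncl q) z) z :=
  ((𝒟.contDiffAt_localIncl hz).differentiableAt (by simp)).hasFDerivAt

theorem Distribution.fderiv_localIncl_fst (hz : z.1 ∈ paramDomain E F D q) (X : E × F) :
    (fderiv ℝ (𝒟.localIncl q) z X).1 = X.1 := by
  have h1 := (hasFDerivAt_fst (𝕜 := ℝ)).comp z (𝒟.hasFDerivAt_localIncl hz)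
  have h2 : HasFDerivAt (Prod.fst ∘ 𝒟.localIncl q) (ContinuousLinearMap.fst ℝ E F) z := by
    refine hasFDerivAt_fst.congr_of_eventuallyEq ?_
    filter_upwards [eventually_paramDomain hz] with z' hz'
    simp [𝒟.localIncl_eq hz']
  exact DFunLike.congr_fun (h1.unique h2) X

theorem Distribution.fderiv_localIncl_inr (hz : z.1 ∈ paramDomain E F D q) (c : F) :
    fderiv ℝ (𝒟.localIncl q) z (0, c) = (0, 𝒟.localFibreIncl q z.1 c) := by
  have hι : HasFDerivAt (fun w : F => (z.1, w)) (ContinuousLinearMap.inr ℝ E F) z.2 :=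
    (hasFDerivAt_const z.1 z.2).prodMk (hasFDerivAt_id z.2)
  have h1 := (𝒟.hasFDerivAt_localIncl (z := (z.1, z.2)) hz).comp z.2 hι
  have h2 : HasFDerivAt (𝒟.localIncl q ∘ fun w : F => (z.1, w))
      ((ContinuousLinearMap.inr ℝ E E).comp (𝒟.localFibreIncl q z.1)) z.2 := by
    have : 𝒟.localIncl q ∘ (fun w : F => (z.1, w)) =
        fun w => (z.1, 𝒟.localFibreIncl q z.1 w) := by
      funext w
      exact 𝒟.localIncl_eq (z := (z.1, w)) hz
    rw [this]
    exact (hasFDerivAt_const z.1 z.2).prodMk (𝒟.localFibreIncl q z.1).hasFDerivAt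
  exact DFunLike.congr_fun (h1.unique h2) c

theorem Distribution.tangentIncl_dParam (hz : z.1 ∈ paramDomain E F D q) (X : E × F) :
    𝒟.tangentIncl (bundleParam q z) (dParam D q z X) =
      frameAt q (𝒟.localIncl q z) (𝒟.toTangent (bundleParam q z))
        (fderiv ℝ (𝒟.localIncl q) z X) := by
  have h1 := ((𝒟.contMDiff_incl.contMDiffAt (x := bundleParam q z)).mdifferentiableAt
    (by simp)).hasMFDerivAt.comp z (hasMFDerivAt_bundleParam hz)
  have h2 := (hasMFDerivAt_bundleParam (W := fun p : Q => TangentSpace 𝓘(ℝ, E) p)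
    (𝒟.localIncl_fst_mem hz)).comp z (𝒟.hasFDerivAt_localIncl hz).hasMFDerivAt
  have h3 := h2.congr_of_eventuallyEq (f₁ := 𝒟.toTangent ∘ bundleParam q) (by
    filter_upwards [eventually_paramDomain hz] with z' hz'
    exact 𝒟.toTangent_bundleParam hz')
  exact DFunLike.congr_fun (hasMFDerivAt_unique h1 h3) X

end Distributions

/-! ### Constraint forces and the nonholonomic equation in coordinates. -/

section LocalEquations

set_option linter.unusedSectionVars false

variable {E : Type*} [NormedAddCommGroup E] [NormedSpace ℝ E]
  {Q : Type*} [TopologicalSpace Q] [ChartedSpace E Q] [IsManifold 𝓘(ℝ, E) ∞ Q]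
  {F : Type*} [NormedAddCommGroup F] [NormedSpace ℝ F]
  {D : Q → Type*} [TopologicalSpace (TotalSpace F D)] [∀ q, TopologicalSpace (D q)]
  [∀ q, AddCommGroup (D q)] [∀ q, Module ℝ (D q)] [FiberBundle F D] [VectorBundle ℝ F D]
  [ContMDiffVectorBundle ∞ F D 𝓘(ℝ, E)]
  {L : TangentBundle 𝓘(ℝ, E) Q → ℝ} {𝒟 : Distribution E F D} {q : Q} {z : E × F}

variable (𝒟) in
/-- The frame of `T(TQ)` along `D` given by the local coordinates. -/
def Distribution.frame (q : Q) (z : E × F) :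
    E × E →L[ℝ] TangentSpace (𝓘(ℝ, E).tangent) (𝒟.toTangent (bundleParam q z)) :=
  frameAt q (𝒟.localIncl q z) (𝒟.toTangent (bundleParam q z))

theorem Distribution.frame_bijective (hz : z.1 ∈ paramDomain E F D q) :
    Function.Bijective (𝒟.frame q z) :=
  frameAt_bijective (𝒟.toTangent_bundleParam hz) (𝒟.localIncl_fst_mem hz)

theorem Distribution.tangentIncl_eq_frame (hz : z.1 ∈ paramDomain E F D q) (X : E × F) :
    𝒟.tangentIncl (bundleParam q z) (dParam D q z X) =
      𝒟.frame q z (fderiv ℝ (𝒟.localIncl q) z X) :=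
  𝒟.tangentIncl_dParam hz X

theorem Distribution.frame_fibreIncl_mem (hz : z.1 ∈ paramDomain E F D q) (c : F) :
    𝒟.frame q z (0, 𝒟.localFibreIncl q z.1 c) ∈
      LinearMap.range (𝒟.tangentIncl (bundleParam q z)).toLinearMap := by
  refine ⟨dParam D q z (0, c), ?_⟩
  have := 𝒟.tangentIncl_eq_frame hz (0, c)
  rw [𝒟.fderiv_localIncl_inr hz] at this
  exact this

theorem Distribution.verticalEndomorphism_frame (hz : z.1 ∈ paramDomain E F D q) (Y : E × E) :
    verticalEndomorphism (𝒟.toTangent (bundleParam q z)) (𝒟.frame q z Y) =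
      𝒟.frame q z (0, Y.1) :=
  verticalEndomorphism_frameAt (𝒟.toTangent_bundleParam hz) (𝒟.localIncl_fst_mem hz) Y

theorem forceAnnihilator_apply_vertical (hz : z.1 ∈ paramDomain E F D q)
    {α : Module.Dual ℝ (TangentSpace (𝓘(ℝ, E).tangent) (𝒟.toTangent (bundleParam q z)))}
    (hα : α ∈ 𝒟.forceAnnihilator (bundleParam q z)) (b : E) : α (𝒟.frame q z (0, b)) = 0 := by
  obtain ⟨β, hβ, rfl⟩ := hα
  have h1 : verticalEndomorphism (𝒟.toTangent (bundleParam q z)) (𝒟.frame q z (0, b)) = 0 := by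
    rw [𝒟.verticalEndomorphism_frame hz]
    exact map_zero (𝒟.frame q z)
  exact (congrArg β h1).trans (map_zero β)

theorem forceAnnihilator_apply_fibreIncl (hz : z.1 ∈ paramDomain E F D q)
    {α : Module.Dual ℝ (TangentSpace (𝓘(ℝ, E).tangent) (𝒟.toTangent (bundleParam q z)))}
    (hα : α ∈ 𝒟.forceAnnihilator (bundleParam q z)) (c : F) :
    α (𝒟.frame q z (𝒟.localFibreIncl q z.1 c, 0)) = 0 := by
  obtain ⟨β, hβ, rfl⟩ := hα
  have h1 := 𝒟.verticalEndomorphism_frame hz (𝒟.localFibreIncl q z.1 c, 0)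
  exact (congrArg β h1).trans
    ((Submodule.mem_dualAnnihilator β).1 hβ _ (𝒟.frame_fibreIncl_mem hz c))

/-- Converse of the two preceding lemmas: together they identify the constraint forces with the
covectors `Y ↦ λ(Y.1)` for which `λ` vanishes on the range of `A`. -/
theorem exists_mem_forceAnnihilator (hz : z.1 ∈ paramDomain E F D q) (lam : E →ₗ[ℝ] ℝ)
    (hlam : ∀ c, lam (𝒟.localFibreIncl q z.1 c) = 0) :
    ∃ α ∈ 𝒟.forceAnnihilator (bundleParam q z), ∀ Y, α (𝒟.frame q z Y) = lam Y.1 := by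
  set T := LinearEquiv.ofBijective (𝒟.frame q z).toLinearMap (𝒟.frame_bijective hz) with hT
  set Dj := fderiv ℝ (𝒟.localIncl q) z with hDj
  -- Subtracting the second component of `Dj(Y.1, 0)` leaves `A X.2` when `Y = Dj X`, so `m`
  -- vanishes on vectors tangent to `D`; on vertical vectors it is still `λ`.
  set m : E × E →ₗ[ℝ] ℝ := lam.comp (LinearMap.snd ℝ E E -
    (LinearMap.snd ℝ E E).comp (Dj.toLinearMap.comp
      ((LinearMap.inl ℝ E F).comp (LinearMap.fst ℝ E E)))) with hm
  have hmY : ∀ Y : E × E, m Y = lam (Y.2 - (Dj (Y.1, 0)).2) := fun Y => rfl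
  set β : Module.Dual ℝ (TangentSpace (𝓘(ℝ, E).tangent) (𝒟.toTangent (bundleParam q z))) :=
    m.comp T.symm.toLinearMap with hβ
  have hβT : ∀ Y, β (𝒟.frame q z Y) = m Y := fun Y => congrArg m (T.symm_apply_apply Y)
  refine ⟨_, ⟨β, ?_, rfl⟩, fun Y => ?_⟩
  · rw [SetLike.mem_coe, Distribution.tangentAnnihilator, Submodule.mem_dualAnnihilator]
    rintro _ ⟨X, rfl⟩
    obtain ⟨X, rfl⟩ := dParam_surjective hz X
    have h1 := congrArg β (𝒟.tangentIncl_eq_frame hz X)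
    refine h1.trans ((hβT _).trans ?_)
    rw [hmY, 𝒟.fderiv_localIncl_fst hz]
    have h2 : Dj X = Dj (X.1, 0) + Dj (0, X.2) := by rw [← map_add]; simp
    rw [← hDj, h2, 𝒟.fderiv_localIncl_inr hz]
    simpa using hlam X.2
  · have h1 := congrArg β (𝒟.verticalEndomorphism_frame hz Y)
    refine h1.trans ((hβT _).trans ?_)
    rw [hmY]
    have h0 : ((0 : E), (0 : F)) = 0 := rfl
    simp [h0]

/-- Forces vanish on `(0, b)` and on `(A c, 0)`. The first test and regularity of `L` give the
second-order condition `X.1 = y`; the second then gives the Lagrange–d'Alembert equations.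
Conversely, these make the remaining covector one of the forces of `exists_mem_forceAnnihilator`. -/
theorem isNonholonomicVector_dParam_iff (hL : ContMDiff (𝓘(ℝ, E).tangent) 𝓘(ℝ, ℝ) ∞ L)
    (hreg : IsRegularLagrangian L) (hz : z.1 ∈ paramDomain E F D q) (X : E × F) :
    IsNonholonomicVector L 𝒟 (bundleParam q z) (dParam D q z X) ↔
      X.1 = (𝒟.localIncl q z).2 ∧ ∀ c, localHessian L q (𝒟.localIncl q z)
        (fderiv ℝ (𝒟.localIncl q) z X) (0, 𝒟.localFibreIncl q z.1 c) =
          fderiv ℝ (localLagrangian L q) (𝒟.localIncl q z) (𝒟.localFibreIncl q z.1 c, 0) := by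
  set y := (𝒟.localIncl q z).2 with hy
  set H := localHessian L q (𝒟.localIncl q z) with hH
  have hu := 𝒟.toTangent_bundleParam hz
  have hz' := 𝒟.localIncl_fst_mem hz
  have hsymm : ∀ X Y, H X Y = H Y X := localHessian_symm hL hz'
  have h00 : ((0 : E), (0 : E)) = 0 := rfl
  have hEq : ∀ Y : E × E, cartanTwoForm L (𝒟.toTangent (bundleParam q z))
      (𝒟.tangentIncl (bundleParam q z) (dParam D q z X)) (𝒟.frame q z Y)
      - differential (𝓘(ℝ, E).tangent) (energy L) (𝒟.toTangent (bundleParam q z)) (𝒟.frame q z Y)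
      = H Y (0, X.1) - H (fderiv ℝ (𝒟.localIncl q) z X) (0, Y.1) - (H Y (0, y) -
        fderiv ℝ (localLagrangian L q) (𝒟.localIncl q z) (Y.1, 0)) := by
    intro Y
    rw [𝒟.tangentIncl_eq_frame hz]
    refine congrArg₂ (· - ·) ((cartanTwoForm_frameAt hL hu hz' _ Y).trans ?_)
      (differential_energy_frameAt hL hu hz' Y)
    rw [𝒟.fderiv_localIncl_fst hz]
  constructor
  · rintro ⟨α, hα, h⟩
    have hX : X.1 = y := by
      rw [← sub_eq_zero]
      refine hreg.localHessian_nondegenerate hL hz' _ fun b => ?_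
      have h1 := (hEq (0, b)).symm.trans
        ((h _).trans (forceAnnihilator_apply_vertical hz hα b))
      have h2 : ((0 : E), X.1 - y) = (0, X.1) - (0, y) := by simp
      rw [← hH, hsymm, h2, map_sub]
      simpa [h00] using h1
    refine ⟨hX, fun c => ?_⟩
    have h1 := (hEq (𝒟.localFibreIncl q z.1 c, 0)).symm.trans
      ((h _).trans (forceAnnihilator_apply_fibreIncl hz hα c))
    rw [hX] at h1
    linarith
  · rintro ⟨hX, h⟩
    obtain ⟨α, hα, hαY⟩ := exists_mem_forceAnnihilator (𝒟 := 𝒟) hz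
      ((fderiv ℝ (localLagrangian L q) (𝒟.localIncl q z)).toLinearMap.comp (LinearMap.inl ℝ E E) -
        (H (fderiv ℝ (𝒟.localIncl q) z X)).toLinearMap.comp (LinearMap.inr ℝ E E))
      (fun c => by simpa [sub_eq_zero] using (h c).symm)
    refine ⟨α, hα, fun Y => ?_⟩
    obtain ⟨Y, rfl⟩ := (𝒟.frame_bijective hz).2 Y
    rw [hαY, hEq, hX]
    simp only [LinearMap.sub_apply, LinearMap.comp_apply, LinearMap.inl_apply, LinearMap.inr_apply,
      ContinuousLinearMap.coe_coe]
    ring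

variable (L 𝒟) in
/-- The Hessian of the restricted Lagrangian along the fibres of `D`, in local coordinates. -/
def fibreHessian (q : Q) (z : E × F) : F →L[ℝ] F →L[ℝ] ℝ :=
  ((ContinuousLinearMap.compL ℝ F (E × E) ℝ).flip
    ((fderiv ℝ (𝒟.localIncl q) z).comp (ContinuousLinearMap.inr ℝ E F))).comp
    ((localHessian L q (𝒟.localIncl q z)).comp
      ((fderiv ℝ (𝒟.localIncl q) z).comp (ContinuousLinearMap.inr ℝ E F)))

theorem fibreHessian_apply (b c : F) : fibreHessian L 𝒟 q z b c =
    localHessian L q (𝒟.localIncl q z) (fderiv ℝ (𝒟.localIncl q) z (0, b))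
      (fderiv ℝ (𝒟.localIncl q) z (0, c)) := rfl

/-- For `b` in the kernel, `X = (0, A b)` is vertical and tangent to `D`, and `i_X ω_L = -D²ℓ(X)(0,
·)` kills the range of `A`, so it is a constraint force. Compatibility gives `X = 0`, and `A` is
injective. -/
theorem fibreHessian_injective (hL : ContMDiff (𝓘(ℝ, E).tangent) 𝓘(ℝ, ℝ) ∞ L)
    (hreg : IsRegularSystem L 𝒟) (hz : z.1 ∈ paramDomain E F D q) :
    Function.Injective (fibreHessian L 𝒟 q z) := by
  rw [injective_iff_map_eq_zero]
  intro b hb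
  have hu := 𝒟.toTangent_bundleParam hz
  have hz' := 𝒟.localIncl_fst_mem hz
  have h00 : ((0 : E), (0 : E)) = 0 := rfl
  set A := 𝒟.localFibreIncl q z.1 with hA
  set H := localHessian L q (𝒟.localIncl q z) with hH
  obtain ⟨α, hα, hαY⟩ := exists_mem_forceAnnihilator (𝒟 := 𝒟) hz
    (-(H (0, A b)).toLinearMap.comp (LinearMap.inr ℝ E E)) (fun c => by
      have h1 := DFunLike.congr_fun hb c
      rw [fibreHessian_apply, 𝒟.fderiv_localIncl_inr hz, 𝒟.fderiv_localIncl_inr hz] at h1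
      simpa using h1)
  have h0 := hreg.compatible (bundleParam q z) (𝒟.frame q z (0, A b))
    (𝒟.frame_fibreIncl_mem hz b) ⟨α, hα, fun Y => by
      obtain ⟨Y, rfl⟩ := (𝒟.frame_bijective hz).2 Y
      rw [hαY]
      refine (cartanTwoForm_frameAt hL hu hz' _ Y).trans ?_
      simp [h00, hH]⟩
  have h1 : ((0 : E), A b) = 0 := (𝒟.frame_bijective hz).1 (h0.trans (map_zero _).symm)
  exact 𝒟.localFibreIncl_injective hz ((congrArg Prod.snd h1).trans (map_zero _).symm)

theorem exists_equiv_of_injective_toDual [FiniteDimensional ℝ F] {B : F →L[ℝ] F →L[ℝ] ℝ}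
    (hB : Function.Injective B) : ∃ e : F ≃L[ℝ] (F →L[ℝ] ℝ), (e : F →L[ℝ] F →L[ℝ] ℝ) = B := by
  have hfin : Module.finrank ℝ F = Module.finrank ℝ (F →L[ℝ] ℝ) := by
    rw [← (LinearMap.toContinuousLinearMap (𝕜 := ℝ) (E := F) (F' := ℝ)).finrank_eq]
    exact Subspace.dual_finrank_eq.symm
  refine ⟨(LinearEquiv.ofInjectiveOfFinrankEq B.toLinearMap hB hfin).toContinuousLinearEquiv, ?_⟩
  ext x y
  rfl

variable (L 𝒟) in
/-- The forces in the fibre directions, in local coordinates. -/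
def localForce (q : Q) (z : E × F) : F →L[ℝ] ℝ :=
  ((fderiv ℝ (localLagrangian L q) (𝒟.localIncl q z)).comp
    ((ContinuousLinearMap.inl ℝ E E).comp (ContinuousLinearMap.snd ℝ E E))
    - localHessian L q (𝒟.localIncl q z)
      (fderiv ℝ (𝒟.localIncl q) z ((𝒟.localIncl q z).2, 0))).comp
    ((fderiv ℝ (𝒟.localIncl q) z).comp (ContinuousLinearMap.inr ℝ E F))

theorem localForce_apply (c : F) : localForce L 𝒟 q z c =
    fderiv ℝ (localLagrangian L q) (𝒟.localIncl q z) ((fderiv ℝ (𝒟.localIncl q) z (0, c)).2, 0)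
    - localHessian L q (𝒟.localIncl q z)
      (fderiv ℝ (𝒟.localIncl q) z ((𝒟.localIncl q z).2, 0))
      (fderiv ℝ (𝒟.localIncl q) z (0, c)) := rfl

variable (L 𝒟) in
/-- The nonholonomic vector field in local coordinates. -/
def localField (q : Q) (z : E × F) : E × F :=
  ((𝒟.localIncl q z).2, (fibreHessian L 𝒟 q z).inverse (localForce L 𝒟 q z))

/-- Splitting `Dj X` into horizontal and fibre parts turns the equations into `B X.2 = r`. The
solution is unique, so the value chosen in `nhField` must be this one. -/
theorem nhField_bundleParam [FiniteDimensional ℝ F]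
    (hL : ContMDiff (𝓘(ℝ, E).tangent) 𝓘(ℝ, ℝ) ∞ L)
    (hreg : IsRegularSystem L 𝒟) (hz : z.1 ∈ paramDomain E F D q) :
    nhField L 𝒟 (bundleParam q z) = dParam D q z (localField L 𝒟 q z) := by
  obtain ⟨e, he⟩ := exists_equiv_of_injective_toDual (fibreHessian_injective hL hreg hz)
  have key : ∀ X : E × F, IsNonholonomicVector L 𝒟 (bundleParam q z) (dParam D q z X) ↔
      X = localField L 𝒟 q z := by
    intro X
    rw [isNonholonomicVector_dParam_iff hL hreg.regular hz, localField, ← he,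
      ContinuousLinearMap.inverse_equiv, Prod.ext_iff]
    refine and_congr_right fun hX => ?_
    have h1 : X.2 = e.symm (localForce L 𝒟 q z) ↔
        fibreHessian L 𝒟 q z X.2 = localForce L 𝒟 q z := by
      rw [ContinuousLinearEquiv.eq_symm_apply, ← he]; rfl
    refine Iff.trans ?_ h1.symm
    rw [ContinuousLinearMap.ext_iff]
    refine forall_congr' fun c => ?_
    have h2 : fderiv ℝ (𝒟.localIncl q) z X = fderiv ℝ (𝒟.localIncl q) z (X.1, 0)
        + fderiv ℝ (𝒟.localIncl q) z (0, X.2) := by rw [← map_add]; simp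
    rw [fibreHessian_apply, localForce_apply, h2, hX, map_add, add_apply,
      𝒟.fderiv_localIncl_inr hz c]
    constructor <;> intro h <;> linarith
  have hex : ∃ X, IsNonholonomicVector L 𝒟 (bundleParam q z) X := ⟨_, (key _).2 rfl⟩
  rw [nhField, dif_pos hex]
  obtain ⟨X, hX⟩ := dParam_surjective hz hex.choose
  rw [← hX]
  exact congrArg (dParam D q z) ((key X).1 (hX ▸ hex.choose_spec))

end LocalEquations

/-! ### Regularity of a vector field read off from a parametrization. -/

section VectorFieldRegularity

variable {V : Type*} [NormedAddCommGroup V] [NormedSpace ℝ V]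
  {H : Type*} [TopologicalSpace H] {J : ModelWithCorners ℝ V H}
  {M : Type*} [TopologicalSpace M] [ChartedSpace H M] [IsManifold J 2 M]
  {Z : Type*} [NormedAddCommGroup Z] [NormedSpace ℝ Z]

/-- A vector field which has regular components in a local parametrization is regular. -/
theorem contMDiffAt_vectorField_of_param {X : ∀ x : M, TangentSpace J x} {χ : Z → M} {g : M → Z}
    {f : Z → Z} {u₀ : M} (hχ : ContMDiffAt 𝓘(ℝ, Z) J 2 χ (g u₀))
    (hg : ContMDiffAt J 𝓘(ℝ, Z) 1 g u₀) (hf : ContDiffAt ℝ 1 f (g u₀))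
    (hχg : ∀ᶠ u in 𝓝 u₀, χ (g u) = u)
    (hX : ∀ᶠ z in 𝓝 (g u₀), X (χ z) = mfderiv 𝓘(ℝ, Z) J χ z (f z)) :
    ContMDiffAt J J.tangent 1 (fun u => (⟨u, X u⟩ : TangentBundle J M)) u₀ := by
  have hu₀ : χ (g u₀) = u₀ := hχg.self_of_nhds
  set κ := extChartAt J u₀ with hκ
  have hκχ : ContDiffAt ℝ 2 (κ ∘ χ) (g u₀) := by
    rw [← contMDiffAt_iff_contDiffAt]
    refine ContMDiffAt.comp (g u₀) ?_ hχ
    rw [hu₀]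
    exact contMDiffAt_extChartAt
  have hsrc : ∀ᶠ z in 𝓝 (g u₀), χ z ∈ (chartAt H u₀).source := by
    refine hχ.continuousAt.eventually_mem ?_
    rw [hu₀]
    exact chart_source_mem_nhds H u₀
  -- In the chart `κ` the components of `X` are `D(κ ∘ χ)` applied to `f`. One derivative of `χ` is
  -- lost, whence the `C²` hypothesis.
  have hev : ∀ᶠ z in 𝓝 (g u₀), (trivializationAt V (TangentSpace J) u₀
      (⟨χ z, X (χ z)⟩ : TangentBundle J M)).2 = fderiv ℝ (κ ∘ χ) z (f z) := by
    filter_upwards [hsrc, hX, contMDiffAt_iff_contMDiffAt_nhds (by simp) |>.1 hχ] with z hz hXz hχz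
    have h1 : MDifferentiableAt J 𝓘(ℝ, V) κ (χ z) := mdifferentiableAt_extChartAt hz
    have h2 := h1.hasMFDerivAt.comp z (hχz.mdifferentiableAt two_ne_zero).hasMFDerivAt
    have h3 := DFunLike.congr_fun h2.mfderiv (f z)
    rw [mfderiv_eq_fderiv] at h3
    have h4 := DFunLike.congr_fun
      (TangentBundle.continuousLinearMapAt_trivializationAt (I := J) hz) (X (χ z))
    have hb : χ z ∈ (trivializationAt V (TangentSpace J) u₀).baseSet := hz
    rw [Trivialization.continuousLinearMapAt_apply, Trivialization.linearMapAt_apply,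
      if_pos hb] at h4
    exact h4.trans ((congrArg (mfderiv J 𝓘(ℝ, V) κ (χ z)) hXz).trans h3.symm)
  rw [contMDiffAt_section]
  have hsm : ContMDiffAt J 𝓘(ℝ, V) 1 (fun u => fderiv ℝ (κ ∘ χ) (g u) (f (g u))) u₀ := by
    have h1 : ContDiffAt ℝ 1 (fun z => fderiv ℝ (κ ∘ χ) z (f z)) (g u₀) :=
      (hκχ.fderiv_right (m := 1) (by norm_num)).clm_apply hf
    exact h1.contMDiffAt.comp u₀ hg
  refine hsm.congr_of_eventuallyEq ?_
  filter_upwards [hg.continuousAt.eventually hev, hχg] with u h1 h2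
  rw [h2] at h1
  exact h1

end VectorFieldRegularity

/-! ### Regularity of the nonholonomic vector field. -/

section FieldRegularity

variable {E : Type*} [NormedAddCommGroup E] [NormedSpace ℝ E]
  {Q : Type*} [TopologicalSpace Q] [ChartedSpace E Q] [IsManifold 𝓘(ℝ, E) ∞ Q]
  {F : Type*} [NormedAddCommGroup F] [NormedSpace ℝ F]
  {D : Q → Type*} [TopologicalSpace (TotalSpace F D)] [∀ q, TopologicalSpace (D q)]
  [∀ q, AddCommGroup (D q)] [∀ q, Module ℝ (D q)] [FiberBundle F D] [VectorBundle ℝ F D]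
  [ContMDiffVectorBundle ∞ F D 𝓘(ℝ, E)]
  {L : TangentBundle 𝓘(ℝ, E) Q → ℝ} {𝒟 : Distribution E F D} {q : Q} {z : E × F}

theorem contDiffAt_fderiv_localLagrangian_localIncl
    (hL : ContMDiff (𝓘(ℝ, E).tangent) 𝓘(ℝ, ℝ) ∞ L) (hz : z.1 ∈ paramDomain E F D q) :
    ContDiffAt ℝ ∞ (fun z => fderiv ℝ (localLagrangian L q) (𝒟.localIncl q z)) z :=
  ((contDiffAt_localLagrangian hL (𝒟.localIncl_fst_mem hz)).fderiv_right
    (m := ∞) le_rfl).comp z (𝒟.contDiffAt_localIncl hz)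

theorem contDiffAt_localHessian_localIncl
    (hL : ContMDiff (𝓘(ℝ, E).tangent) 𝓘(ℝ, ℝ) ∞ L) (hz : z.1 ∈ paramDomain E F D q) :
    ContDiffAt ℝ ∞ (fun z => localHessian L q (𝒟.localIncl q z)) z :=
  (((contDiffAt_localLagrangian hL (𝒟.localIncl_fst_mem hz)).fderiv_right
    (m := ∞) le_rfl).fderiv_right (m := ∞) le_rfl).comp z (𝒟.contDiffAt_localIncl hz)

theorem contDiffAt_fibreHessian [FiniteDimensional ℝ F]
    (hL : ContMDiff (𝓘(ℝ, E).tangent) 𝓘(ℝ, ℝ) ∞ L) (hz : z.1 ∈ paramDomain E F D q) :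
    ContDiffAt ℝ ∞ (fibreHessian L 𝒟 q) z := by
  have hopen : IsOpen {z : E × F | z.1 ∈ paramDomain E F D q} :=
    (isOpen_paramDomain F D q).preimage continuous_fst
  refine ContDiffOn.contDiffAt ?_ (hopen.mem_nhds hz)
  refine contDiffOn_clm_apply.2 fun b => contDiffOn_clm_apply.2 fun c => ?_
  intro z' hz'
  have hDj : ContDiffAt ℝ ∞ (fderiv ℝ (𝒟.localIncl q)) z' :=
    (𝒟.contDiffAt_localIncl hz').fderiv_right (m := ∞) le_rfl
  have hK : ∀ c : F, ContDiffAt ℝ ∞ (fun z => fderiv ℝ (𝒟.localIncl q) z (0, c)) z' :=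
    fun c => hDj.clm_apply contDiffAt_const
  simp only [fibreHessian_apply]
  exact (((contDiffAt_localHessian_localIncl hL hz').clm_apply (hK b)).clm_apply
    (hK c)).contDiffWithinAt

theorem contDiffAt_localField [FiniteDimensional ℝ F]
    (hL : ContMDiff (𝓘(ℝ, E).tangent) 𝓘(ℝ, ℝ) ∞ L)
    (hreg : IsRegularSystem L 𝒟) (hz : z.1 ∈ paramDomain E F D q) :
    ContDiffAt ℝ ∞ (localField L 𝒟 q) z := by
  have hj := 𝒟.contDiffAt_localIncl hz
  have hDj : ContDiffAt ℝ ∞ (fderiv ℝ (𝒟.localIncl q)) z := hj.fderiv_right (m := ∞) le_rfl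
  have hK : ContDiffAt ℝ ∞ (fun z => (fderiv ℝ (𝒟.localIncl q) z).comp
      (ContinuousLinearMap.inr ℝ E F)) z := hDj.clm_comp contDiffAt_const
  have hH := contDiffAt_localHessian_localIncl (𝒟 := 𝒟) hL hz
  have hy : ContDiffAt ℝ ∞ (fun z => (𝒟.localIncl q z).2) z := contDiffAt_snd.comp z hj
  have hB : ContDiffAt ℝ ∞ (fibreHessian L 𝒟 q) z :=
    contDiffAt_fibreHessian hL hz
  have hr : ContDiffAt ℝ ∞ (localForce L 𝒟 q) z :=
    (((contDiffAt_fderiv_localLagrangian_localIncl hL hz).clm_comp contDiffAt_const).sub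
      (hH.clm_apply (hDj.clm_apply (hy.prodMk contDiffAt_const)))).clm_comp hK
  have : CompleteSpace F := FiniteDimensional.complete ℝ F
  obtain ⟨e, he⟩ := exists_equiv_of_injective_toDual (fibreHessian_injective hL hreg hz)
  -- Inversion is smooth at invertible maps, and `B` is invertible here by compatibility.
  have hinv : ContDiffAt ℝ ∞ ContinuousLinearMap.inverse (fibreHessian L 𝒟 q z) := by
    rw [← he]; exact contDiffAt_map_inverse e
  exact hy.prodMk ((hinv.comp z hB).clm_apply hr)

theorem contMDiffAt_nhField [FiniteDimensional ℝ F]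
    (hL : ContMDiff (𝓘(ℝ, E).tangent) 𝓘(ℝ, ℝ) ∞ L)
    (hreg : IsRegularSystem L 𝒟) (v : TotalSpace F D) :
    ContMDiffAt (𝓘(ℝ, E).prod 𝓘(ℝ, F)) (𝓘(ℝ, E).prod 𝓘(ℝ, F)).tangent 1
      (fun u => (⟨u, nhField L 𝒟 u⟩ :
        TangentBundle (𝓘(ℝ, E).prod 𝓘(ℝ, F)) (TotalSpace F D))) v := by
  have hv : v.proj ∈ coordDomain E F D v.proj := mem_coordDomain F D v.proj
  have hz : (bundleCoord E v.proj v).1 ∈ paramDomain E F D v.proj := paramDomain_of_coordDomain hv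
  have : IsManifold (𝓘(ℝ, E).prod 𝓘(ℝ, F)) ∞ (TotalSpace F D) := inferInstance
  have : IsManifold (𝓘(ℝ, E).prod 𝓘(ℝ, F)) 2 (TotalSpace F D) := IsManifold.of_le
    (n := ∞) (by norm_cast)
  refine contMDiffAt_vectorField_of_param (χ := bundleParam v.proj) (g := bundleCoord E v.proj)
    (f := localField L 𝒟 v.proj) ((contMDiffAt_bundleParam hz).of_le (by norm_cast))
    ((contMDiffAt_bundleCoord hv).of_le (by norm_cast))
    ((contDiffAt_localField hL hreg hz).of_le (by norm_cast)) ?_ ?_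
  · exact (eventually_coordDomain hv).mono fun u hu => bundleParam_coord hu
  · exact (eventually_paramDomain hz).mono fun z' hz' => nhField_bundleParam hL hreg hz'

end FieldRegularity

/-! ### The nonholonomic Legendre map in coordinates is a local diffeomorphism. -/

section Legendre

set_option linter.unusedSectionVars false

variable {E : Type*} [NormedAddCommGroup E] [NormedSpace ℝ E]
  {Q : Type*} [TopologicalSpace Q] [ChartedSpace E Q] [IsManifold 𝓘(ℝ, E) ∞ Q]
  {F : Type*} [NormedAddCommGroup F] [NormedSpace ℝ F]
  {D : Q → Type*} [TopologicalSpace (TotalSpace F D)] [∀ q, TopologicalSpace (D q)]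
  [∀ q, AddCommGroup (D q)] [∀ q, Module ℝ (D q)] [FiberBundle F D] [VectorBundle ℝ F D]
  [ContMDiffVectorBundle ∞ F D 𝓘(ℝ, E)]
  {L : TangentBundle 𝓘(ℝ, E) Q → ℝ} {𝒟 : Distribution E F D} {q : Q} {z : E × F}

/-- The fibre derivative can be computed in any local parametrization. -/
theorem fibreDerivative_bundleParam {f : TotalSpace F D → ℝ}
    (hf : ContMDiff (𝓘(ℝ, E).prod 𝓘(ℝ, F)) 𝓘(ℝ, ℝ) ∞ f) (hz : z.1 ∈ paramDomain E F D q) (c : F) :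
    fibreDerivative f (bundleParam q z)
      ((trivializationAt F D q).symmL ℝ ((chartAt E q).symm z.1) c) =
      fderiv ℝ (fun z : E × F => f (bundleParam q z)) z (0, c) := by
  have hsm : ∀ {q' : Q} {z' : E × F}, z'.1 ∈ paramDomain E F D q' →
      DifferentiableAt ℝ (fun z : E × F => f (bundleParam q' z)) z' := by
    intro q' z' hz'
    have h1 : ContMDiffAt 𝓘(ℝ, E × F) 𝓘(ℝ, ℝ) ∞ (fun z : E × F => f (bundleParam q' z)) z' :=
      (hf.contMDiffAt (x := bundleParam q' z')).comp z' (contMDiffAt_bundleParam hz')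
    exact h1.contDiffAt.differentiableAt (by simp)
  have hline : ∀ (x : E) (w : F), HasFDerivAt (fun w : F => (x, w))
      (ContinuousLinearMap.inr ℝ E F) w :=
    fun x w => (hasFDerivAt_const x w).prodMk (hasFDerivAt_id w)
  set p : Q := (chartAt E q).symm z.1 with hp
  have hdiff : ∀ w, DifferentiableAt ℝ
      (fun w : F => f ⟨p, (trivializationAt F D p).symmL ℝ p w⟩) w := by
    intro w
    have hx : chartAt E p p ∈ paramDomain E F D p :=
      paramDomain_of_coordDomain (mem_coordDomain F D p)
    have h1 := (hsm (z' := (chartAt E p p, w)) hx).comp w (hline (chartAt E p p) w).differentiableAt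
    refine h1.congr_of_eventuallyEq (Filter.Eventually.of_forall fun w' => ?_)
    have h2 : (chartAt E p).symm (chartAt E p p) = p := (chartAt E p).left_inv (mem_chart_source E p)
    have h3 : ∀ p', p' = p → (⟨p, (trivializationAt F D p).symmL ℝ p w'⟩ : TotalSpace F D) =
        ⟨p', (trivializationAt F D p).symmL ℝ p' w'⟩ := by rintro _ rfl; rfl
    exact congrArg f (h3 _ h2)
  -- The definition uses the trivialization at the point itself, which moves with `z`. The
  -- directional derivative is free of that choice and can be recomputed in the one fixed at `q`.
  have h1 := fibreDerivative_apply f (bundleParam q z) (hdiff _)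
    ((trivializationAt F D q).symmL ℝ p c)
  refine h1.trans ?_
  have h2 : HasDerivAt (fun t : ℝ => z + t • ((0 : E), c)) (0, c) 0 := by
    simpa using ((hasDerivAt_id (0 : ℝ)).smul_const ((0 : E), c)).const_add z
  have h3 : HasFDerivAt (fun z : E × F => f (bundleParam q z))
      (fderiv ℝ (fun z : E × F => f (bundleParam q z)) z) (z + (0 : ℝ) • ((0 : E), c)) := by
    simpa using (hsm hz).hasFDerivAt
  have h4 := h3.comp_hasDerivAt (0 : ℝ) h2
  have h5 : ((fun z : E × F => f (bundleParam q z)) ∘ fun t : ℝ => z + t • ((0 : E), c)) =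
      fun t : ℝ => f ⟨p, (trivializationAt F D q).symmL ℝ p z.2 +
        t • (trivializationAt F D q).symmL ℝ p c⟩ := by
    funext t
    have h6 : z + t • ((0 : E), c) = (z.1, z.2 + t • c) := by ext <;> simp
    rw [← map_smul, ← map_add]
    exact congrArg (fun z => f (bundleParam q z)) h6
  rw [h5] at h4
  exact h4.deriv

variable (L 𝒟) in
/-- The fibre part of the nonholonomic Legendre map in local coordinates. -/
def localMomentum (q : Q) (z : E × F) : F →L[ℝ] ℝ :=
  (fderiv ℝ (localLagrangian L q) (𝒟.localIncl q z)).comp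
    ((fderiv ℝ (𝒟.localIncl q) z).comp (ContinuousLinearMap.inr ℝ E F))

variable (L 𝒟) in
/-- The nonholonomic Legendre map in local coordinates. -/
def localLegendre (q : Q) (z : E × F) : E × (F →L[ℝ] ℝ) := (z.1, localMomentum L 𝒟 q z)

theorem dual_paramDomain (q : Q) :
    paramDomain E (F →L[ℝ] ℝ) (fun q => D q →L[ℝ] Bundle.Trivial Q ℝ q) q = paramDomain E F D q := by
  ext x
  simp [paramDomain]

theorem dual_coordDomain (q : Q) :
    coordDomain E (F →L[ℝ] ℝ) (fun q => D q →L[ℝ] Bundle.Trivial Q ℝ q) q = coordDomain E F D q := by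
  ext x
  simp [coordDomain]

theorem bundleCoord_nhLegendre (hL : ContMDiff (𝓘(ℝ, E).tangent) 𝓘(ℝ, ℝ) ∞ L)
    (hz : z.1 ∈ paramDomain E F D q) :
    bundleCoord E q (nhLegendre L 𝒟 (bundleParam q z)) = localLegendre L 𝒟 q z := by
  refine Prod.ext ((chartAt E q).right_inv hz.1) ?_
  ext c
  have hf : ContMDiff (𝓘(ℝ, E).prod 𝓘(ℝ, F)) 𝓘(ℝ, ℝ) ∞
      (fun u : TotalSpace F D => L (𝒟.toTangent u)) := hL.comp 𝒟.contMDiff_incl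
  have h1 := fibreDerivative_bundleParam hf hz c
  have h2 : HasFDerivAt (fun z : E × F => L (𝒟.toTangent (bundleParam q z)))
      ((fderiv ℝ (localLagrangian L q) (𝒟.localIncl q z)).comp (fderiv ℝ (𝒟.localIncl q) z)) z := by
    refine HasFDerivAt.congr_of_eventuallyEq (f := localLagrangian L q ∘ 𝒟.localIncl q) ?_ ?_
    · exact ((contDiffAt_localLagrangian hL (𝒟.localIncl_fst_mem hz)).differentiableAt
        (by simp)).hasFDerivAt.comp z (𝒟.hasFDerivAt_localIncl hz)
    · filter_upwards [eventually_paramDomain hz] with z' hz'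
      rw [𝒟.toTangent_bundleParam hz']; rfl
  rw [h2.fderiv] at h1
  refine Eq.trans ?_ h1
  have hb : (nhLegendre L 𝒟 (bundleParam q z)).proj ∈
      (trivializationAt (F →L[ℝ] ℝ) (fun q => D q →L[ℝ] Bundle.Trivial Q ℝ q) q).baseSet :=
    ⟨hz.2, mem_univ _⟩
  rw [bundleCoord, Trivialization.continuousLinearMapAt_apply, Trivialization.linearMapAt_apply,
    if_pos hb, hom_trivializationAt_apply]
  exact DFunLike.congr_fun (Bundle.Trivial.continuousLinearMapAt_trivialization ℝ Q ℝ _) _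

theorem contDiffAt_localLegendre
    (hL : ContMDiff (𝓘(ℝ, E).tangent) 𝓘(ℝ, ℝ) ∞ L) (hz : z.1 ∈ paramDomain E F D q) :
    ContDiffAt ℝ ∞ (localLegendre L 𝒟 q) z := by
  have hDj : ContDiffAt ℝ ∞ (fderiv ℝ (𝒟.localIncl q)) z :=
    (𝒟.contDiffAt_localIncl hz).fderiv_right (m := ∞) le_rfl
  exact contDiffAt_fst.prodMk ((contDiffAt_fderiv_localLagrangian_localIncl hL hz).clm_comp
    (hDj.clm_comp contDiffAt_const))

theorem fderiv_localLegendre_fst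
    (hL : ContMDiff (𝓘(ℝ, E).tangent) 𝓘(ℝ, ℝ) ∞ L) (hz : z.1 ∈ paramDomain E F D q) (X : E × F) :
    (fderiv ℝ (localLegendre L 𝒟 q) z X).1 = X.1 := by
  have h1 := (hasFDerivAt_fst (𝕜 := ℝ)).comp z
    ((contDiffAt_localLegendre (𝒟 := 𝒟) hL hz).differentiableAt (by simp)).hasFDerivAt
  have h2 : HasFDerivAt (Prod.fst ∘ localLegendre L 𝒟 q) (ContinuousLinearMap.fst ℝ E F) z :=
    hasFDerivAt_fst
  exact DFunLike.congr_fun (h1.unique h2) X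

/-- The derivative of the Legendre map along the fibres is the fibre Hessian. -/
theorem fderiv_localLegendre_inr
    (hL : ContMDiff (𝓘(ℝ, E).tangent) 𝓘(ℝ, ℝ) ∞ L) (hz : z.1 ∈ paramDomain E F D q) (b : F) :
    (fderiv ℝ (localLegendre L 𝒟 q) z (0, b)).2 = fibreHessian L 𝒟 q z b := by
  ext c
  have hι : HasFDerivAt (fun w : F => (z.1, w)) (ContinuousLinearMap.inr ℝ E F) z.2 :=
    (hasFDerivAt_const z.1 z.2).prodMk (hasFDerivAt_id z.2)
  have h1 := (((contDiffAt_localLegendre (𝒟 := 𝒟) (z := (z.1, z.2)) hL hz).differentiableAt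
    (by simp)).hasFDerivAt.comp z.2 hι).snd.clm_apply (hasFDerivAt_const c z.2)
  have h2 : (fun w : F => ((localLegendre L 𝒟 q ∘ fun w : F => (z.1, w)) w).2 c) =
      fun w => fderiv ℝ (localLagrangian L q) (𝒟.localIncl q (z.1, w))
        (0, 𝒟.localFibreIncl q z.1 c) := by
    funext w
    exact congrArg (fderiv ℝ (localLagrangian L q) (𝒟.localIncl q (z.1, w)))
      (𝒟.fderiv_localIncl_inr (z := (z.1, w)) hz c)
  rw [h2] at h1
  have h3 := (((hasFDerivAt_fderiv_localLagrangian hL (𝒟.localIncl_fst_mem hz)).comp z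
    (𝒟.hasFDerivAt_localIncl hz)).comp (f := fun w : F => (z.1, w)) z.2 hι).clm_apply
      (hasFDerivAt_const ((0 : E), 𝒟.localFibreIncl q z.1 c) z.2)
  have h4 := DFunLike.congr_fun (h1.unique h3) b
  rw [fibreHessian_apply, 𝒟.fderiv_localIncl_inr hz c]
  simpa using h4

/-- The derivative is block triangular with diagonal blocks the identity of `E` and `B`, hence
injective between spaces of equal dimension. -/
theorem exists_equiv_fderiv_localLegendre [FiniteDimensional ℝ E] [FiniteDimensional ℝ F]
    (hL : ContMDiff (𝓘(ℝ, E).tangent) 𝓘(ℝ, ℝ) ∞ L)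
    (hreg : IsRegularSystem L 𝒟) (hz : z.1 ∈ paramDomain E F D q) :
    ∃ e : (E × F) ≃L[ℝ] E × (F →L[ℝ] ℝ),
      HasFDerivAt (localLegendre L 𝒟 q) (e : E × F →L[ℝ] E × (F →L[ℝ] ℝ)) z := by
  have hinj : Function.Injective (fderiv ℝ (localLegendre L 𝒟 q) z) := by
    rw [injective_iff_map_eq_zero]
    rintro ⟨a, b⟩ h
    have ha : a = 0 := by
      have := fderiv_localLegendre_fst (𝒟 := 𝒟) hL hz (a, b)
      rw [h] at this
      exact this.symm
    subst ha
    have hb := fderiv_localLegendre_inr (𝒟 := 𝒟) hL hz b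
    rw [h] at hb
    have : b = 0 := fibreHessian_injective hL hreg hz (hb.symm.trans (map_zero _).symm)
    rw [this]; rfl
  obtain ⟨e₀, -⟩ := exists_equiv_of_injective_toDual (fibreHessian_injective hL hreg hz)
  have hfin : Module.finrank ℝ (E × F) = Module.finrank ℝ (E × (F →L[ℝ] ℝ)) :=
    ((LinearEquiv.refl ℝ E).prodCongr e₀.toLinearEquiv).finrank_eq
  refine ⟨(LinearEquiv.ofInjectiveOfFinrankEq (fderiv ℝ (localLegendre L 𝒟 q) z).toLinearMap
    hinj hfin).toContinuousLinearEquiv, ?_⟩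
  exact ((contDiffAt_localLegendre hL hz).differentiableAt (by simp)).hasFDerivAt

theorem nhLegendre_bundleParam (hL : ContMDiff (𝓘(ℝ, E).tangent) 𝓘(ℝ, ℝ) ∞ L)
    (hz : z.1 ∈ paramDomain E F D q) :
    nhLegendre L 𝒟 (bundleParam q z) = bundleParam q (localLegendre L 𝒟 q z) := by
  rw [← bundleCoord_nhLegendre hL hz]
  refine (bundleParam_coord ?_).symm
  rw [dual_coordDomain]
  exact coordDomain_of_paramDomain hz

theorem contMDiffAt_nhLegendre_bundleParam (hL : ContMDiff (𝓘(ℝ, E).tangent) 𝓘(ℝ, ℝ) ∞ L)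
    (hz : z.1 ∈ paramDomain E F D q) :
    ContMDiffAt 𝓘(ℝ, E × F) (𝓘(ℝ, E).prod 𝓘(ℝ, F →L[ℝ] ℝ)) ∞
      (fun z : E × F => nhLegendre L 𝒟 (bundleParam q z)) z := by
  have h1 : (localLegendre L 𝒟 q z).1 ∈
      paramDomain E (F →L[ℝ] ℝ) (fun q => D q →L[ℝ] Bundle.Trivial Q ℝ q) q := by
    rw [dual_paramDomain]; exact hz
  refine ((contMDiffAt_bundleParam h1).comp z
    (contDiffAt_localLegendre (𝒟 := 𝒟) hL hz).contMDiffAt).congr_of_eventuallyEq ?_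
  filter_upwards [eventually_paramDomain hz] with z' hz'
  exact nhLegendre_bundleParam hL hz'

theorem contMDiff_nhLegendre (hL : ContMDiff (𝓘(ℝ, E).tangent) 𝓘(ℝ, ℝ) ∞ L) :
    ContMDiff (𝓘(ℝ, E).prod 𝓘(ℝ, F)) (𝓘(ℝ, E).prod 𝓘(ℝ, F →L[ℝ] ℝ)) ∞ (nhLegendre L 𝒟) := by
  intro v
  have hv : v.proj ∈ coordDomain E F D v.proj := mem_coordDomain F D v.proj
  refine ((contMDiffAt_nhLegendre_bundleParam (𝒟 := 𝒟) hL (paramDomain_of_coordDomain hv)).comp v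
    (contMDiffAt_bundleCoord hv)).congr_of_eventuallyEq ?_
  filter_upwards [eventually_coordDomain hv] with u hu
  simp only [Function.comp_apply, bundleParam_coord hu]

end Legendre

/-! ### Push-forward of vector fields and of their trajectories. -/

section Pushforward

variable {V : Type*} [NormedAddCommGroup V] [NormedSpace ℝ V]
  {H : Type*} [TopologicalSpace H] {J : ModelWithCorners ℝ V H}
  {M : Type*} [TopologicalSpace M] [ChartedSpace H M]
  {V' : Type*} [NormedAddCommGroup V'] [NormedSpace ℝ V']
  {H' : Type*} [TopologicalSpace H'] {J' : ModelWithCorners ℝ V' H'}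
  {M' : Type*} [TopologicalSpace M'] [ChartedSpace H' M']
  {f : M → M'} {S : Set M} {X : ∀ x : M, TangentSpace J x}

theorem pushforward_apply (h : IsProjectableOn (J' := J') f S X) {x : M} (hx : x ∈ S) :
    pushforward (J' := J') f S X (f x) = mfderiv J J' f x (X x) := by
  have hex : ∃ y ∈ S, f y = f x := ⟨x, hx, rfl⟩
  -- Projectability is an equality in the tangent bundle, so it compares vectors at the
  -- propositionally equal base points occurring in the cast.
  have cast_eq : ∀ {a b : M'} (e : a = b) (w : TangentSpace J' a) (w' : TangentSpace J' b),
      (⟨a, w⟩ : TangentBundle J' M') = ⟨b, w'⟩ → (e ▸ w : TangentSpace J' b) = w' := by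
    rintro a _ rfl w w' hw
    exact eq_of_heq (TotalSpace.mk.inj hw).2
  rw [pushforward, dif_pos hex]
  exact cast_eq _ _ _ (h _ hex.choose_spec.1 x hx hex.choose_spec.2)

theorem IsTrajectory.pushforward {γ : ℝ → M} {T : ℝ} (hγ : IsTrajectory X γ T)
    (h : IsProjectableOn (J' := J') f S X) (hf : MDifferentiable J J' f) (hS : IsOpen S)
    (hT : 0 ≤ T) (hγS : ∀ t ∈ Icc 0 T, γ t ∈ S) :
    IsTrajectory (pushforward (J' := J') f S X) (f ∘ γ) T := by
  -- A trajectory must extend past both ends of `[0, T]`; openness of `S` keeps the curve inside `S`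
  -- there for a short time.
  have hend : ∀ t ∈ Icc 0 T, ∃ δ > 0, ∀ s, |s - t| < δ → γ s ∈ S := fun t ht => by
    have := (hγ.isMIntegralCurveAt ht).continuousAt.eventually_mem (hS.mem_nhds (hγS t ht))
    obtain ⟨δ, hδ, h⟩ := Metric.eventually_nhds_iff.1 this
    exact ⟨δ, hδ, fun s hs => h (by rwa [Real.dist_eq])⟩
  obtain ⟨δ₀, hδ₀, h₀⟩ := hend 0 ⟨le_rfl, hT⟩
  obtain ⟨δ₁, hδ₁, h₁⟩ := hend T ⟨hT, le_rfl⟩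
  obtain ⟨ε, hε, hγ⟩ := hγ
  refine ⟨min ε (min δ₀ δ₁), lt_min hε (lt_min hδ₀ hδ₁), fun t ht => ?_⟩
  have e1 := min_le_left ε (min δ₀ δ₁)
  have e2 := (min_le_right ε (min δ₀ δ₁)).trans (min_le_left δ₀ δ₁)
  have e3 := (min_le_right ε (min δ₀ δ₁)).trans (min_le_right δ₀ δ₁)
  have hsub : Ioo (-min ε (min δ₀ δ₁)) (T + min ε (min δ₀ δ₁)) ⊆ Ioo (-ε) (T + ε) :=
    Ioo_subset_Ioo (by linarith) (by linarith)
  have htS : γ t ∈ S := by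
    rcases lt_or_ge t 0 with h | h
    · exact h₀ t (by rw [sub_zero, abs_lt]; constructor <;> linarith [ht.1])
    · rcases le_or_gt t T with h' | h'
      · exact hγS t ⟨h, h'⟩
      · exact h₁ t (by rw [abs_lt]; constructor <;> linarith [ht.2])
  have h1 := (hf (γ t)).hasMFDerivAt.comp_hasMFDerivWithinAt t (hγ.mono hsub t ht)
  have h2 : (mfderiv J J' f (γ t)).comp ((1 : ℝ →L[ℝ] ℝ).smulRight (X (γ t))) =
      (1 : ℝ →L[ℝ] ℝ).smulRight (Nonholonomic.pushforward (J' := J') f S X (f (γ t))) := by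
    rw [pushforward_apply h htS]
    ext
    simp
  exact h2 ▸ h1

end Pushforward

/-! ### Regularity of the push-forward on the dual bundle. -/

section DualField

variable {E : Type*} [NormedAddCommGroup E] [NormedSpace ℝ E] [FiniteDimensional ℝ E]
  {Q : Type*} [TopologicalSpace Q] [ChartedSpace E Q] [IsManifold 𝓘(ℝ, E) ∞ Q]
  {F : Type*} [NormedAddCommGroup F] [NormedSpace ℝ F] [FiniteDimensional ℝ F]
  {D : Q → Type*} [TopologicalSpace (TotalSpace F D)] [∀ q, TopologicalSpace (D q)]
  [∀ q, AddCommGroup (D q)] [∀ q, Module ℝ (D q)] [FiberBundle F D] [VectorBundle ℝ F D]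
  [ContMDiffVectorBundle ∞ F D 𝓘(ℝ, E)]
  {L : TangentBundle 𝓘(ℝ, E) Q → ℝ} {𝒟 : Distribution E F D}

/-- Near `Fl(v)` the Legendre map after the coordinates of `D` parametrizes `D^*`, with inverse
built from the local inverse `σ`. Projectability lets the push-forward be computed at the preimage
given by `σ`, even when there are others in `S`. -/
theorem contMDiffAt_nhDualField
    (hL : ContMDiff (𝓘(ℝ, E).tangent) 𝓘(ℝ, ℝ) ∞ L) (hreg : IsRegularSystem L 𝒟)
    {S : Set (TotalSpace F D)} (hS : IsOpen S)
    (hproj : IsProjectableOn (J' := 𝓘(ℝ, E).prod 𝓘(ℝ, F →L[ℝ] ℝ)) (nhLegendre L 𝒟) S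
      (nhField L 𝒟)) {v : TotalSpace F D} (hvS : v ∈ S) :
    ContMDiffAt (𝓘(ℝ, E).prod 𝓘(ℝ, F →L[ℝ] ℝ)) (𝓘(ℝ, E).prod 𝓘(ℝ, F →L[ℝ] ℝ)).tangent 1
      (fun μ => (⟨μ, nhDualField L 𝒟 S μ⟩ :
        TangentBundle (𝓘(ℝ, E).prod 𝓘(ℝ, F →L[ℝ] ℝ)) (DualBundle F D))) (nhLegendre L 𝒟 v) := by
  set q := v.proj with hq
  set z := bundleCoord E q v with hz_def
  have hv : v.proj ∈ coordDomain E F D q := mem_coordDomain F D q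
  have hz : z.1 ∈ paramDomain E F D q := paramDomain_of_coordDomain hv
  have hχv : bundleParam q z = v := bundleParam_coord hv
  have : IsManifold (𝓘(ℝ, E).prod 𝓘(ℝ, F →L[ℝ] ℝ)) ∞ (DualBundle F D) := inferInstance
  have : IsManifold (𝓘(ℝ, E).prod 𝓘(ℝ, F →L[ℝ] ℝ)) 2 (DualBundle F D) := IsManifold.of_le
    (n := ∞) (by norm_cast)
  have : CompleteSpace (E × F) := FiniteDimensional.complete ℝ (E × F)
  set μ := nhLegendre L 𝒟 v with hμ
  have hμd : μ.proj ∈ coordDomain E (F →L[ℝ] ℝ) (fun q => D q →L[ℝ] Bundle.Trivial Q ℝ q) q := by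
    rw [dual_coordDomain]; exact hv
  have hcμ : bundleCoord E q μ = localLegendre L 𝒟 q z := by
    rw [hμ, ← hχv]; exact bundleCoord_nhLegendre hL hz
  obtain ⟨e, he⟩ := exists_equiv_fderiv_localLegendre hL hreg hz
  have hP : ContDiffAt ℝ ∞ (localLegendre L 𝒟 q) z := contDiffAt_localLegendre hL hz
  have hstrict := hP.hasStrictFDerivAt' he (by simp)
  set σ := hP.localInverse he (by simp) with hσ
  have hσz : σ (localLegendre L 𝒟 q z) = z := hP.localInverse_apply_image he (by simp)
  have hσc : ContDiffAt ℝ ∞ σ (localLegendre L 𝒟 q z) := hP.to_localInverse he (by simp)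
  have hσr : ∀ᶠ y in 𝓝 (localLegendre L 𝒟 q z), localLegendre L 𝒟 q (σ y) = y :=
    hstrict.eventually_right_inverse
  have hg0 : σ (bundleCoord E q μ) = z := by rw [hcμ, hσz]
  have hg : ContMDiffAt (𝓘(ℝ, E).prod 𝓘(ℝ, F →L[ℝ] ℝ)) 𝓘(ℝ, E × F) 1
      (fun μ : DualBundle F D => σ (bundleCoord E q μ)) μ := by
    have h1 : ContMDiffAt 𝓘(ℝ, E × (F →L[ℝ] ℝ)) 𝓘(ℝ, E × F) ∞ σ (bundleCoord E q μ) := by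
      rw [hcμ]; exact hσc.contMDiffAt
    exact (h1.comp μ (contMDiffAt_bundleCoord hμd)).of_le (by norm_cast)
  refine contMDiffAt_vectorField_of_param (χ := fun z => nhLegendre L 𝒟 (bundleParam q z))
    (g := fun μ => σ (bundleCoord E q μ)) (f := localField L 𝒟 q) ?_ hg ?_ ?_ ?_
  · rw [hg0]
    exact (contMDiffAt_nhLegendre_bundleParam hL hz).of_le (by norm_cast)
  · rw [hg0]
    exact (contDiffAt_localField hL hreg hz).of_le (by norm_cast)
  · have h1 : ∀ᶠ μ' in 𝓝 μ, (σ (bundleCoord E q μ')).1 ∈ paramDomain E F D q := by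
      refine Filter.Tendsto.eventually hg.continuousAt
        (p := fun z' => z'.1 ∈ paramDomain E F D q) ?_
      simp only [hg0]
      exact eventually_paramDomain hz
    have h2 : ∀ᶠ μ' in 𝓝 μ,
        localLegendre L 𝒟 q (σ (bundleCoord E q μ')) = bundleCoord E q μ' := by
      refine Filter.Tendsto.eventually (contMDiffAt_bundleCoord hμd).continuousAt
        (p := fun y => localLegendre L 𝒟 q (σ y) = y) ?_
      rw [hcμ]
      exact hσr
    filter_upwards [h1, h2, eventually_coordDomain hμd] with μ' h1 h2 h3
    rw [nhLegendre_bundleParam hL h1, h2, bundleParam_coord h3]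
  · rw [hg0]
    have hSz : ∀ᶠ z' in 𝓝 z, bundleParam q z' ∈ S := by
      refine (contMDiffAt_bundleParam hz).continuousAt.eventually_mem (hS.mem_nhds ?_)
      rw [hχv]; exact hvS
    filter_upwards [hSz, eventually_paramDomain hz] with z' hz'S hz'
    have h1 := ((contMDiff_nhLegendre (𝒟 := 𝒟) hL).mdifferentiable (by simp)
      (bundleParam q z')).hasMFDerivAt.comp z' (hasMFDerivAt_bundleParam hz')
    have h2 := DFunLike.congr_fun h1.mfderiv (localField L 𝒟 q z')
    refine (pushforward_apply hproj hz'S).trans (Eq.trans ?_ h2.symm)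
    rw [nhField_bundleParam hL hreg hz']
    rfl

end DualField

/-! ### Trajectories, retractions and the exact discrete flow. -/

section ExactDiscreteFlow

set_option linter.unusedSectionVars false

variable {E : Type*} [NormedAddCommGroup E] [NormedSpace ℝ E] [FiniteDimensional ℝ E]
  {Q : Type*} [TopologicalSpace Q] [T2Space Q] [ChartedSpace E Q] [IsManifold 𝓘(ℝ, E) ∞ Q]
  {F : Type*} [NormedAddCommGroup F] [NormedSpace ℝ F] [FiniteDimensional ℝ F]
  {D : Q → Type*} [TopologicalSpace (TotalSpace F D)] [∀ q, TopologicalSpace (D q)]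
  [∀ q, AddCommGroup (D q)] [∀ q, Module ℝ (D q)] [FiberBundle F D] [VectorBundle ℝ F D]
  [ContMDiffVectorBundle ∞ F D 𝓘(ℝ, E)]
  {L : TangentBundle 𝓘(ℝ, E) Q → ℝ} {𝒟 : Distribution E F D} {h : ℝ}
  {U : TopologicalSpace.Opens (TotalSpace F D)}

theorem nhField_trajectory_eqOn (hL : ContMDiff (𝓘(ℝ, E).tangent) 𝓘(ℝ, ℝ) ∞ L)
    (hreg : IsRegularSystem L 𝒟) {γ γ' : ℝ → TotalSpace F D} {T : ℝ}
    (hγ : IsTrajectory (nhField L 𝒟) γ T) (hγ' : IsTrajectory (nhField L 𝒟) γ' T)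
    (h0 : γ 0 = γ' 0) : EqOn γ γ' (Icc 0 T) := by
  have : T2Space (TotalSpace F D) := totalSpace_t2Space D
  have : IsManifold (𝓘(ℝ, E).prod 𝓘(ℝ, F)) 1 (TotalSpace F D) := IsManifold.of_le
    (n := ∞) (by norm_cast)
  exact hγ.eqOn (fun t _ => contMDiffAt_nhField hL hreg (γ t)) hγ' h0

theorem nhField_flow_eq (hL : ContMDiff (𝓘(ℝ, E).tangent) 𝓘(ℝ, ℝ) ∞ L)
    (hreg : IsRegularSystem L 𝒟) {γ : ℝ → TotalSpace F D} {T t : ℝ}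
    (hγ : IsTrajectory (nhField L 𝒟) γ T) (ht : t ∈ Icc 0 T) :
    flow (nhField L 𝒟) t (γ 0) = γ t := by
  have : T2Space (TotalSpace F D) := totalSpace_t2Space D
  have : IsManifold (𝓘(ℝ, E).prod 𝓘(ℝ, F)) 1 (TotalSpace F D) := IsManifold.of_le
    (n := ∞) (by norm_cast)
  exact hγ.flow_eq (fun t _ => contMDiffAt_nhField hL hreg (γ t)) ht

theorem nhField_trajectory_concat (hL : ContMDiff (𝓘(ℝ, E).tangent) 𝓘(ℝ, ℝ) ∞ L)
    (hreg : IsRegularSystem L 𝒟) {γ γ' : ℝ → TotalSpace F D} {T T' : ℝ} (hT : 0 ≤ T)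
    (hT' : 0 ≤ T') (hγ : IsTrajectory (nhField L 𝒟) γ T)
    (hγ' : IsTrajectory (nhField L 𝒟) γ' T') (h : γ T = γ' 0) :
    IsTrajectory (nhField L 𝒟) (fun t => if t ≤ T then γ t else γ' (t - T)) (T + T') := by
  have : IsManifold (𝓘(ℝ, E).prod 𝓘(ℝ, F)) 1 (TotalSpace F D) := IsManifold.of_le
    (n := ∞) (by norm_cast)
  exact IsTrajectory.concat (contMDiffAt_nhField hL hreg (γ T)) hT hT' hγ hγ' h

theorem retractionMinus_mem {x : Q × Q} (hx : x ∈ exactConstraint L 𝒟 h U) :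
    retractionMinus L 𝒟 h U x ∈ U := by
  have hx' : ∃ v ∈ U, nhExp L 𝒟 h v = x := hx
  rw [retractionMinus, dif_pos hx']
  exact hx'.choose_spec.1

theorem nhExp_retractionMinus {x : Q × Q} (hx : x ∈ exactConstraint L 𝒟 h U) :
    nhExp L 𝒟 h (retractionMinus L 𝒟 h U x) = x := by
  have hx' : ∃ v ∈ U, nhExp L 𝒟 h v = x := hx
  rw [retractionMinus, dif_pos hx']
  exact hx'.choose_spec.2

/-- The only consequence of the embedding property that is needed: `exp_h` is injective on `U`, so
the preimage chosen in `R⁻` is the only one. -/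
theorem IsExpDomain.eq_retractionMinus (hU : IsExpDomain L 𝒟 h U) {v : TotalSpace F D}
    (hv : v ∈ U) {x : Q × Q} (hvx : nhExp L 𝒟 h v = x) : v = retractionMinus L 𝒟 h U x := by
  have hx : x ∈ exactConstraint L 𝒟 h U := ⟨v, hv, hvx⟩
  have hinj := hU.isSmoothEmbedding.isEmbedding.injective
  have := @hinj ⟨v, hv⟩ ⟨_, retractionMinus_mem hx⟩ (hvx.trans (nhExp_retractionMinus hx).symm)
  exact congrArg Subtype.val this

/-- Trajectories of length `h` which fit together form a trajectory. -/
theorem exists_trajectory_through (hL : ContMDiff (𝓘(ℝ, E).tangent) 𝓘(ℝ, ℝ) ∞ L)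
    (hreg : IsRegularSystem L 𝒟) (hh : 0 < h) (v : ℕ → TotalSpace F D) (n : ℕ)
    (hv : ∀ k ≤ n, v k ∈ flowDomain (nhField L 𝒟) h)
    (hstep : ∀ k < n, v (k + 1) = flow (nhField L 𝒟) h (v k)) :
    ∃ γ : ℝ → TotalSpace F D, IsTrajectory (nhField L 𝒟) γ ((n + 1 : ℕ) * h) ∧
      (∀ k ≤ n, γ (k * h) = v k) ∧ γ ((n + 1 : ℕ) * h) = flow (nhField L 𝒟) h (v n) := by
  induction n with
  | zero =>
    obtain ⟨γ, hγ0, hγ⟩ := hv 0 le_rfl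
    refine ⟨γ, by simpa using hγ, fun k hk => ?_, ?_⟩
    · obtain rfl : k = 0 := by omega
      simpa using hγ0
    · rw [← hγ0, nhField_flow_eq hL hreg hγ ⟨hh.le, le_rfl⟩]
      simp
  | succ n ih =>
    obtain ⟨γ, hγ, hγv, hγh⟩ := ih (fun k hk => hv k (by omega)) (fun k hk => hstep k (by omega))
    obtain ⟨γ', hγ'0, hγ'⟩ := hv (n + 1) le_rfl
    have hT : 0 ≤ ((n + 1 : ℕ) : ℝ) * h := by positivity
    have hjoin : γ ((n + 1 : ℕ) * h) = γ' 0 := by rw [hγh, hγ'0, hstep n (by omega)]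
    have hsum : ((n + 1 + 1 : ℕ) : ℝ) * h = (n + 1 : ℕ) * h + h := by push_cast; ring
    refine ⟨_, hsum ▸ nhField_trajectory_concat hL hreg hT hh.le hγ hγ' hjoin, fun k hk => ?_, ?_⟩
    · have hle : (k : ℝ) * h ≤ (n + 1 : ℕ) * h := by gcongr
      simp only [if_pos hle]
      rcases Nat.lt_or_ge n k with hlt | hge
      · obtain rfl : k = n + 1 := by omega
        rw [hjoin, hγ'0]
      · exact hγv k hge
    · have hnle : ¬ ((n + 1 + 1 : ℕ) : ℝ) * h ≤ (n + 1 : ℕ) * h := by rw [hsum]; linarith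
      simp only [if_neg hnle]
      rw [hsum, add_sub_cancel_left, ← hγ'0, nhField_flow_eq hL hreg hγ' ⟨hh.le, le_rfl⟩]

theorem nhLegendre_trajectory (hL : ContMDiff (𝓘(ℝ, E).tangent) 𝓘(ℝ, ℝ) ∞ L)
    (hreg : IsRegularSystem L 𝒟) (hh : 0 ≤ h) (S : TopologicalSpace.Opens (TotalSpace F D))
    (hproj : IsProjectableOn (J' := 𝓘(ℝ, E).prod 𝓘(ℝ, F →L[ℝ] ℝ)) (nhLegendre L 𝒟) S
      (nhField L 𝒟)) {γ : ℝ → TotalSpace F D} (hγ : IsTrajectory (nhField L 𝒟) γ h)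
    (hγS : ∀ t ∈ Icc 0 h, γ t ∈ S) :
    nhLegendre L 𝒟 (γ 0) ∈ flowDomain (nhDualField L 𝒟 S) h ∧
      flow (nhDualField L 𝒟 S) h (nhLegendre L 𝒟 (γ 0)) = nhLegendre L 𝒟 (γ h) := by
  have : T2Space (DualBundle F D) := totalSpace_t2Space _
  have : IsManifold (𝓘(ℝ, E).prod 𝓘(ℝ, F →L[ℝ] ℝ)) 1 (DualBundle F D) := IsManifold.of_le
    (n := ∞) (by norm_cast)
  have hc : IsTrajectory (nhDualField L 𝒟 S) (nhLegendre L 𝒟 ∘ γ) h :=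
    hγ.pushforward hproj ((contMDiff_nhLegendre hL).mdifferentiable (by simp)) S.isOpen hh hγS
  refine ⟨⟨_, rfl, hc⟩, ?_⟩
  exact hc.flow_eq (fun t ht => contMDiffAt_nhDualField hL hreg S.isOpen hproj (hγS t ht))
    ⟨hh, le_rfl⟩

end ExactDiscreteFlow

end Nonholonomic

end

/-! ### Proof of the theorem. -/

open Nonholonomic in
theorem mainTheorem3
    {E : Type*} [NormedAddCommGroup E] [NormedSpace ℝ E] [FiniteDimensional ℝ E]
    {Q : Type*} [TopologicalSpace Q] [T2Space Q] [ChartedSpace E Q] [IsManifold 𝓘(ℝ, E) ∞ Q]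
    {F : Type*} [NormedAddCommGroup F] [NormedSpace ℝ F] [FiniteDimensional ℝ F]
    {D : Q → Type*} [TopologicalSpace (TotalSpace F D)] [∀ q, TopologicalSpace (D q)]
    [∀ q, AddCommGroup (D q)] [∀ q, Module ℝ (D q)] [FiberBundle F D] [VectorBundle ℝ F D]
    [ContMDiffVectorBundle ∞ F D 𝓘(ℝ, E)]
    (L : TangentBundle 𝓘(ℝ, E) Q → ℝ)
    (hL : ContMDiff (𝓘(ℝ, E).tangent) 𝓘(ℝ, ℝ) ∞ L)
    (𝒟 : Distribution E F D) (hreg : IsRegularSystem L 𝒟)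
    (h : ℝ) (hh : 0 < h)
    (U : TopologicalSpace.Opens (TotalSpace F D)) (hU : IsExpDomain L 𝒟 h U) :
    -- part 1: iterates of the exact discrete flow
    (∀ (N : ℕ) (q : ℕ → Q), 1 ≤ N →
      (q 0, q 1) ∈ exactConstraint L 𝒟 h U →
      (∀ k, k + 1 < N → (q k, q (k + 1)) ∈ exactFlowDomain L 𝒟 h U ∧
        (q (k + 1), q (k + 2)) = exactFlow L 𝒟 h U (q k, q (k + 1))) →
      -- the exact discrete nonholonomic equations hold
      (∀ k < N, (q k, q (k + 1)) ∈ exactConstraint L 𝒟 h U) ∧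
      (∀ k, k + 1 < N → legendrePlus L 𝒟 h U (q k, q (k + 1)) =
        legendreMinus L 𝒟 h U (q (k + 1), q (k + 2))) ∧
      -- the sequence is sampled from the unique trajectory joining its first two points
      ∃ γ : ℝ → TotalSpace F D,
        (IsTrajectory (nhField L 𝒟) γ (N * h) ∧
          γ 0 ∈ U ∧ (γ 0).proj = q 0 ∧ (γ h).proj = q 1) ∧
        (∀ (T : ℝ) (γ' : ℝ → TotalSpace F D), h ≤ T → IsTrajectory (nhField L 𝒟) γ' T →
          γ' 0 ∈ U → (γ' 0).proj = q 0 → (γ' h).proj = q 1 →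
          EqOn γ' γ (Icc 0 (min T (N * h)))) ∧
        ∀ k ≤ N, q k = (γ (k * h)).proj) ∧
    -- part 2: the Legendre transformations and the flow of the push-forward of the dynamics
    (∀ S : TopologicalSpace.Opens (TotalSpace F D),
      IsProjectableOn (J' := 𝓘(ℝ, E).prod 𝓘(ℝ, F →L[ℝ] ℝ)) (nhLegendre L 𝒟) S (nhField L 𝒟) →
      (∀ x ∈ exactConstraintIn L 𝒟 h U S,
        legendreMinus L 𝒟 h U x ∈ flowDomain (nhDualField L 𝒟 S) h ∧
        legendrePlus L 𝒟 h U x = flow (nhDualField L 𝒟 S) h (legendreMinus L 𝒟 h U x)) ∧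
      (∀ μ ∈ legendreMinus L 𝒟 h U '' exactConstraintIn L 𝒟 h U S,
        flow (nhDualField L 𝒟 S) h μ =
          exactDualFlow L 𝒟 h U (exactConstraintIn L 𝒟 h U S) μ)) := by
  -- The identity `R⁻ ∘ Φ = R⁺`, from which the discrete equations and the matching of successive
  -- arcs both follow.
  have hstep : ∀ x ∈ exactFlowDomain L 𝒟 h U, exactFlow L 𝒟 h U x ∈ exactConstraint L 𝒟 h U ∧
      retractionMinus L 𝒟 h U (exactFlow L 𝒟 h U x) = retractionPlus L 𝒟 h U x :=
    fun x hx => ⟨⟨_, hx.2, rfl⟩, (hU.eq_retractionMinus hx.2 rfl).symm⟩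
  refine ⟨fun N q hN h0 hq => ?_, fun S hproj => ?_⟩
  · have hmem : ∀ k < N, (q k, q (k + 1)) ∈ exactConstraint L 𝒟 h U := by
      rintro (_ | k) hk
      · exact h0
      · rw [(hq k hk).2]
        exact (hstep _ (hq k hk).1).1
    have hret : ∀ k, k + 1 < N → retractionMinus L 𝒟 h U (q (k + 1), q (k + 2)) =
        retractionPlus L 𝒟 h U (q k, q (k + 1)) := by
      intro k hk
      rw [(hq k hk).2]
      exact (hstep _ (hq k hk).1).2
    refine ⟨hmem, fun k hk => congrArg (nhLegendre L 𝒟) (hret k hk).symm, ?_⟩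
    obtain ⟨n, rfl⟩ : ∃ n, N = n + 1 := ⟨N - 1, by omega⟩
    set v : ℕ → TotalSpace F D := fun k => retractionMinus L 𝒟 h U (q k, q (k + 1)) with hv
    have hexp : ∀ k < n + 1, nhExp L 𝒟 h (v k) = (q k, q (k + 1)) :=
      fun k hk => nhExp_retractionMinus (hmem k hk)
    obtain ⟨γ, hγ, hγv, hγN⟩ := exists_trajectory_through hL hreg hh v n
      (fun k hk => hU.subset_flowDomain (retractionMinus_mem (hmem k (by omega))))
      (fun k hk => hret k (by omega))
    have hγq : ∀ k ≤ n + 1, q k = (γ (k * h)).proj := by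
      intro k hk
      -- The last point `q (n + 1)` is not the foot of any `v k`; it is the second component of
      -- `exp_h (v n)`.
      rcases Nat.lt_or_ge n k with hlt | hge
      · obtain rfl : k = n + 1 := by omega
        rw [hγN]
        exact (congrArg Prod.snd (hexp n (by omega))).symm
      · rw [hγv k hge]
        exact (congrArg Prod.fst (hexp k (by omega))).symm
    have hγ0 : γ 0 = v 0 := by simpa using hγv 0 (by omega)
    refine ⟨γ, ⟨hγ, ?_, ?_, ?_⟩, ?_, hγq⟩
    · rw [hγ0]
      exact retractionMinus_mem (hmem 0 (by omega))
    · simpa using (hγq 0 (by omega)).symm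
    · simpa using (hγq 1 (by omega)).symm
    · intro T γ' hT hγ' hγ'U h1 h2
      -- The two base points say that `exp_h (γ' 0) = (q 0, q 1)`, which determines `γ' 0` within
      -- `U`.
      have he : γ' 0 = γ 0 := by
        rw [hγ0]
        refine hU.eq_retractionMinus hγ'U (Prod.ext h1 ?_)
        rw [nhExp, nhField_flow_eq hL hreg hγ' ⟨hh.le, hT⟩]
        exact h2
      exact nhField_trajectory_eqOn hL hreg (hγ'.mono (min_le_left _ _))
        (hγ.mono (min_le_right _ _)) he
  · have key : ∀ x ∈ exactConstraintIn L 𝒟 h U S,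
        legendreMinus L 𝒟 h U x ∈ flowDomain (nhDualField L 𝒟 S) h ∧
        legendrePlus L 𝒟 h U x = flow (nhDualField L 𝒟 S) h (legendreMinus L 𝒟 h U x) := by
      rintro x ⟨hx, hxS⟩
      obtain ⟨γ, hγ0, hγ⟩ := hU.subset_flowDomain (retractionMinus_mem hx)
      have hflow : ∀ t ∈ Icc 0 h,
          flow (nhField L 𝒟) t (retractionMinus L 𝒟 h U x) = γ t := by
        intro t ht
        rw [← hγ0]
        exact nhField_flow_eq hL hreg hγ ht
      obtain ⟨hd, hf⟩ := nhLegendre_trajectory hL hreg hh.le S hproj hγ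
        (fun t ht => hflow t ht ▸ hxS t ht)
      rw [hγ0, ← hflow h ⟨hh.le, le_rfl⟩] at hf
      rw [hγ0] at hd
      exact ⟨hd, hf.symm⟩
    refine ⟨key, fun μ hμ => ?_⟩
    have hμ' : ∃ x ∈ exactConstraintIn L 𝒟 h U S, legendreMinus L 𝒟 h U x = μ := hμ
    -- By `key`, `F⁺l(x)` depends on `x` only through `F⁻l(x)`, so the choice of preimage is
    -- harmless and `F⁻l` need not be injective.
    rw [exactDualFlow, dif_pos hμ', (key _ hμ'.choose_spec.1).2, hμ'.choose_spec.2]
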